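/- A lattice $L$ is an SPS lattice if it is finite and planar (it has a planar Hasse diagram with straight line segments as edges), semimodular, and slim (it has no sublattice isomorphic to $M_3$). A covering square of $L$ is a set $S=\{o,a_l,a_r,i\}$ with $o\prec a_l\prec i$, $o\prec a_r\prec i$, $a_l\neq a_r$; it is tight if $i$ covers exactly two elements, $a_l$ and $a_r$, in $L$. Inserting a fork at $S$ yields the lattice $L[S]$: put $x_{l,1}=a_l$, $y_{l,1}=o$, and, as long as there is a covering square $\{y_{l,k+1},x_{l,k+1},y_{l,k},x_{l,k}\}$ of $L$ with top $x_{l,k}$, bottom $y_{l,k+1}$ and sides $x_{l,k+1}\ne y_{l,k}$, continue with $x_{l,k+1},y_{l,k+1}$; define $x_{r,k},y_{r,k}$ symmetrically, starting with $x_{r,1}=a_r$, $y_{r,1}=o$. The elements of $L[S]$ are those of $L$, a new element $t$, and new elements $z_{l,1},\dots,z_{l,n},z_{r,1},\dots,z_{r,m}$, one for each pair $(x_{l,k},y_{l,k})$ and $(x_{r,k},y_{r,k})$; its order is generated by the order of $L$ and the relations $z_{l,1}<t$, $z_{r,1}<t$, $t<i$, $y_{s,k}<z_{s,k}<x_{s,k}$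 and $z_{s,k+1}<z_{s,k}$ ($s\in\{l,r\}$). For a congruence $\alpha$ of $L$, its minimal extension $\overline{\alpha}$ is the smallest congruence of $L[S]$ that contains $\alpha$. Let $\gamma(S)=\mathrm{con}_{L[S]}(t,i)$ be the smallest congruence of $L[S]$ with $t\equiv i$. A congruence is join-irreducible if it is join-irreducible (in particular, not the least element) in the congruence lattice. **Theorem.** Let $L$ be an SPS lattice and let $S$ be a tight square of $L$. Then $L[S]$ is a lattice that contains $L$ as a sublattice, and it has exactly one join-irreducible congruence that is not the minimal extension $\overline{\alpha}$ of a join-irreducible congruence $\alpha$ of $L$, namely, $\gamma(S)$. -/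

import Mathlib

/-! ## Slim, planar, semimodular lattices -/

/-- A poset is planar if it is finite and has a planar Hasse diagram: the elements are represented
by distinct points of the plane, larger elements are placed higher, every covering pair `a ⋖ b` is
represented by the straight line segment from `a` to `b`, and two different such segments meet at
most in a point that represents a common endpoint. -/
def IsPlanarPoset (L : Type*) [PartialOrder L] : Prop :=
  Finite L ∧ ∃ φ : L → ℝ × ℝ, Function.Injective φ ∧
    (∀ a b : L, a < b → (φ a).2 < (φ b).2) ∧
    ∀ a b c d : L, a ⋖ b → c ⋖ d → (a, b) ≠ (c, d) →
      ∀ P : ℝ × ℝ, P ∈ segment ℝ (φ a) (φ b) → P ∈ segment ℝ (φ c) (φ d) →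
        ∃ e : L, (e = a ∨ e = b) ∧ (e = c ∨ e = d) ∧ P = φ e

/-- A lattice is slim if it has no sublattice isomorphic to `M₃`, i.e., no three distinct elements
that pairwise have the same join and pairwise have the same meet. -/
def IsSlimLattice (L : Type*) [Lattice L] : Prop :=
  ¬ ∃ a b c : L, a ≠ b ∧ b ≠ c ∧ a ≠ c ∧
    a ⊓ b = b ⊓ c ∧ b ⊓ c = a ⊓ c ∧ a ⊔ b = b ⊔ c ∧ b ⊔ c = a ⊔ c

/-- SPS lattices: slim, planar (hence finite), semimodular lattices. -/
structure IsSPS (L : Type*) [Lattice L] : Prop where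
  slim : IsSlimLattice L
  planar : IsPlanarPoset L
  semimodular : IsUpperModularLattice L

/-! ## Covering squares and the fork extension -/

/-- `{o, a, b, i}` is a covering square with bottom `o`, top `i` and sides `a ≠ b`. -/
def IsCoveringSquare {L : Type*} [Lattice L] (o a b i : L) : Prop :=
  a ≠ b ∧ o ⋖ a ∧ o ⋖ b ∧ a ⋖ i ∧ b ⋖ i

/-- In a covering square, the bottom is the meet and the top is the join of the two sides. -/
theorem IsCoveringSquare.inf_eq_and_sup_eq {L : Type*} [Lattice L] {o a b i : L}
    (h : IsCoveringSquare o a b i) : a ⊓ b = o ∧ a ⊔ b = i := by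
  obtain ⟨hab, hoa, hob, hai, hbi⟩ := h
  have hnle : ¬ b ≤ a := fun hle =>
    (hoa.eq_or_eq hob.le hle).elim (fun h => hob.ne h.symm) (fun h => hab h.symm)
  constructor
  · refine (hob.eq_or_eq (le_inf hoa.le hob.le) inf_le_right).resolve_right ?_
    exact fun h => hnle (inf_eq_right.mp h)
  · refine (hai.eq_or_eq le_sup_left (sup_le hai.le hbi.le)).resolve_left ?_
    exact fun h => hnle (sup_eq_left.mp h)

/-- A covering square `{o, al, ar, i}` of a lattice. -/
structure CoveringSquare (L : Type*) [Lattice L] where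
  o : L
  al : L
  ar : L
  i : L
  isCoveringSquare : IsCoveringSquare o al ar i

/-- The two sides of a square. -/
inductive Side : Type
  | left
  | right

namespace CoveringSquare

variable {L : Type*} [Lattice L]

/-- The square `S` is tight if its top covers exactly two elements, `al` and `ar`. -/
def IsTight (S : CoveringSquare L) : Prop :=
  ∀ c : L, c ⋖ S.i ↔ c = S.al ∨ c = S.ar

/-- The side element `al` or `ar`. -/
def side (S : CoveringSquare L) : Side → L
  | Side.left => S.al
  | Side.right => S.ar

/-- `S.Leg s x y` says that `(x, y)` is one of the pairs `(x_{s,k}, y_{s,k})`, `k ≥ 1`, of the fork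
construction on the side `s`: the first pair is `(a_s, o)`, and `(x_{s,k+1}, y_{s,k+1})` is obtained
from `(x_{s,k}, y_{s,k})` by a covering square with bottom `y_{s,k+1}`, sides `x_{s,k+1}` and
`y_{s,k}`, and top `x_{s,k}`. -/
inductive Leg (S : CoveringSquare L) (s : Side) : L → L → Prop
  | base : Leg S s (S.side s) S.o
  | step {x y x' y' : L} : Leg S s x y → IsCoveringSquare y' x' y x → Leg S s x' y'

/-- The underlying set of `L[S]`: the elements of `L`, the element `t`, and a new element
`z_{s,k}` for every pair `(x_{s,k}, y_{s,k})` on either side `s`. -/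
inductive Fork (S : CoveringSquare L) : Type _
  | old (a : L) : Fork S
  | t : Fork S
  | z (s : Side) (x y : L) (h : S.Leg s x y) : Fork S

/-- The relations that generate the order of `L[S]`: those of `L`, `z_{s,1} < t < i`,
`y_{s,k} < z_{s,k} < x_{s,k}`, and `z_{s,k+1} < z_{s,k}`. -/
inductive ForkStep (S : CoveringSquare L) : S.Fork → S.Fork → Prop
  | old {a b : L} : a ≤ b → ForkStep S (Fork.old a) (Fork.old b)
  | t_i : ForkStep S Fork.t (Fork.old S.i)
  | z_t (s : Side) : ForkStep S (Fork.z s (S.side s) S.o Leg.base) Fork.t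
  | y_z (s : Side) {x y : L} (h : S.Leg s x y) : ForkStep S (Fork.old y) (Fork.z s x y h)
  | z_x (s : Side) {x y : L} (h : S.Leg s x y) : ForkStep S (Fork.z s x y h) (Fork.old x)
  | z_z (s : Side) {x y x' y' : L} (h : S.Leg s x y) (hsq : IsCoveringSquare y' x' y x) :
      ForkStep S (Fork.z s x' y' (Leg.step h hsq)) (Fork.z s x y h)

/-- The order of `L[S]`: the reflexive transitive closure of the generating relations. -/
def ForkLE (S : CoveringSquare L) : S.Fork → S.Fork → Prop :=
  Relation.ReflTransGen S.ForkStep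

end CoveringSquare

/-! ## Congruences of lattices -/

namespace LatticeCon

/-- Congruences are ordered by inclusion: `θ ≤ ψ` iff `x ≡ y (θ)` implies `x ≡ y (ψ)`. -/
instance instPartialOrder {K : Type*} [Lattice K] : PartialOrder (LatticeCon K) :=
  PartialOrder.lift LatticeCon.toSetoid (fun c d h => by cases c; cases d; cases h; rfl)

/-- The infimum of a set of congruences is their intersection. -/
instance instInfSet {K : Type*} [Lattice K] : InfSet (LatticeCon K) where
  sInf C :=
    { toSetoid := sInf (LatticeCon.toSetoid '' C)
      inf := by
        rintro w x y z h₁ h₂ _ ⟨c, hc, rfl⟩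
        exact c.inf (h₁ _ ⟨c, hc, rfl⟩) (h₂ _ ⟨c, hc, rfl⟩)
      sup := by
        rintro w x y z h₁ h₂ _ ⟨c, hc, rfl⟩
        exact c.sup (h₁ _ ⟨c, hc, rfl⟩) (h₂ _ ⟨c, hc, rfl⟩) }

/-- The congruence lattice of a lattice. -/
instance instCompleteLattice {K : Type*} [Lattice K] : CompleteLattice (LatticeCon K) :=
  completeLatticeOfInf (LatticeCon K) (fun _ =>
    ⟨fun c hc _ _ h => h c.toSetoid ⟨c, hc, rfl⟩,
      fun _ hd _ _ h _ ⟨_, hc, e⟩ => e ▸ hd hc h⟩)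

/-- The smallest congruence that contains the relation `R`. -/
def gen {K : Type*} [Lattice K] (R : K → K → Prop) : LatticeCon K :=
  sInf {c | ∀ a b : K, R a b → c.r a b}

/-- The principal congruence `con(a, b)`. -/
def principal {K : Type*} [Lattice K] (a b : K) : LatticeCon K :=
  gen (fun x y => x = a ∧ y = b)

end LatticeCon

namespace CoveringSquare

/-- The minimal extension of a congruence `α` of `L` to `L[S]`: the smallest congruence of `L[S]`
that contains `α`. -/
def minimalExtension {L : Type*} [Lattice L] (S : CoveringSquare L) [Lattice S.Fork]
    (α : LatticeCon L) : LatticeCon S.Fork :=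
  LatticeCon.gen (fun p q => ∃ a b : L, α.r a b ∧ p = Fork.old a ∧ q = Fork.old b)

/-- The congruence `γ(S) = con(t, i)` of `L[S]`. -/
def gamma {L : Type*} [Lattice L] (S : CoveringSquare L) [Lattice S.Fork] : LatticeCon S.Fork :=
  LatticeCon.principal Fork.t (Fork.old S.i)

end CoveringSquare

/-! A planar diagram orients incomparable elements from left to right. Together with slimness and
semimodularity, this left-of order shows that every element has at most two upper covers and that
each leg of the fork continues in at most one way, so it is a chain.

An element `p` of `L[S]` is determined by its shadow, the least element of `L` above it, and by
whether `p ≤ t`. This embeds `L[S]` into `L × Prop` with the product order, where joins are computed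
componentwise and meets are corrected below `t`.

In `L[S]`, the prime intervals `[z, x]` are perspective to `[t, i]`, and every other prime interval
lies in `L` or is perspective to a prime interval of `L`. Hence a prime interval of `L[S]` generates
`γ(S)` or the minimal extension of the congruence generated by a prime interval of `L`.

Finally, the shadow preserves meets up to a congruence of `L` that identifies only elements strictly
below `i`. Pulled back along the shadow, this congruence contains `γ(S)`. If `γ(S)` were the minimal
extension of `α`, then `α` would be contained in it too; but then the minimal extension of `α` is
contained in the refinement of the pullback that separates the elements `p ≤ t` from the others, and
this refinement does not identify `t` with `i`. -/

/-! ## Conjugate orders -/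

/-- A conjugate order of a partial order, read as `a` lies to the left of `b`: a transitive relation
that holds between two elements, in one of the two directions, exactly when they are
incomparable. -/
structure IsConjugateOrder {L : Type*} [PartialOrder L] (lam : L → L → Prop) : Prop where
  trans : ∀ {a b c : L}, lam a b → lam b c → lam a c
  not_le : ∀ {a b : L}, lam a b → ¬ a ≤ b
  not_ge : ∀ {a b : L}, lam a b → ¬ b ≤ a
  total : ∀ {a b : L}, ¬ a ≤ b → ¬ b ≤ a → lam a b ∨ lam b a

namespace IsConjugateOrder

variable {L : Type*} [PartialOrder L] {lam : L → L → Prop} {a b c s : L}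

theorem ne (h : IsConjugateOrder lam) (hab : lam a b) : a ≠ b :=
  fun e => h.not_le hab e.le

theorem swap (h : IsConjugateOrder lam) : IsConjugateOrder (fun a b => lam b a) where
  trans hab hbc := h.trans hbc hab
  not_le hab := h.not_ge hab
  not_ge hab := h.not_le hab
  total hab hba := (h.total hab hba).symm

theorem of_le_right (h : IsConjugateOrder lam) (hab : lam a b) (hcb : c ≤ b) (hca : ¬ c ≤ a) :
    lam a c :=
  (h.total (fun hac => h.not_le hab (hac.trans hcb)) hca).resolve_right
    fun hlt => h.not_le (h.trans hlt hab) hcb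

theorem of_ge_right (h : IsConjugateOrder lam) (hab : lam a b) (hbc : b ≤ c) (hac : ¬ a ≤ c) :
    lam a c :=
  (h.total hac (fun hca => h.not_ge hab (hbc.trans hca))).resolve_right
    fun hlt => h.not_ge (h.trans hlt hab) hbc

theorem of_le_left (h : IsConjugateOrder lam) (hab : lam a b) (hca : c ≤ a) (hcb : ¬ c ≤ b) :
    lam c b :=
  h.swap.of_le_right hab hca hcb

theorem of_ge_left (h : IsConjugateOrder lam) (hab : lam a b) (hac : a ≤ c) (hbc : ¬ b ≤ c) :
    lam c b :=
  h.swap.of_ge_right hab hac hbc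

theorem le_of_between (h : IsConjugateOrder lam) (hab : lam a b) (hbc : lam b c)
    (has : a ≤ s) (hcs : c ≤ s) : b ≤ s := by
  by_contra hbs
  exact h.not_le (h.trans hab (h.of_ge_right hbc hcs hbs)) has

theorem ge_of_between (h : IsConjugateOrder lam) (hab : lam a b) (hbc : lam b c)
    (hsa : s ≤ a) (hsc : s ≤ c) : s ≤ b := by
  by_contra hsb
  exact h.not_ge (h.trans hab (h.of_le_right hbc hsc hsb)) hsa

theorem le_of_spanning (h : IsConjugateOrder lam) {e f w : L} (hab : lam a b)
    (has : a ≤ s) (hbs : b ≤ s) (hea : e ≤ a) (heb : ¬ e ≤ b) (hfb : f ≤ b) (hfa : ¬ f ≤ a)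
    (hew : e ≤ w) (hfw : f ≤ w) (haw : ¬ a ≤ w) (hbw : ¬ b ≤ w) : w ≤ s :=
  h.le_of_between (h.of_ge_right (h.of_le_right hab hfb hfa) hfw haw)
    (h.of_ge_left (h.of_le_left hab hea heb) hew hbw) has hbs

end IsConjugateOrder

/-! ## Covering pairs -/

section CovBy

variable {L : Type*}

theorem not_le_of_covBy_of_covBy_left [PartialOrder L] {p a b : L} (ha : p ⋖ a) (hb : p ⋖ b)
    (hab : a ≠ b) : ¬ a ≤ b :=
  fun hle => hb.2 ha.lt (hle.lt_of_ne hab)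

theorem not_le_of_covBy_of_covBy_right [PartialOrder L] {a b q : L} (ha : a ⋖ q) (hb : b ⋖ q)
    (hab : a ≠ b) : ¬ a ≤ b :=
  fun hle => ha.2 (hle.lt_of_ne hab) hb.lt

theorem covBy_sup_of_covBy_of_covBy [Lattice L] [IsWeakUpperModularLattice L] {p a b : L}
    (ha : p ⋖ a) (hb : p ⋖ b) (hab : a ≠ b) : a ⋖ a ⊔ b := by
  obtain rfl := ha.wcovBy.inf_eq hb.wcovBy hab
  exact covBy_sup_of_inf_covBy_of_inf_covBy_left ha hb

theorem IsConjugateOrder.le_or_ge_of_middle [Lattice L] {lam : L → L → Prop}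
    (h : IsConjugateOrder lam) {x a b c w : L} (ha : a ⋖ x) (hb : b ⋖ x) (hc : c ⋖ x)
    (hab : lam a b) (hbc : lam b c) (hbw : b ≤ w) : w ≤ x ∨ x ≤ w := by
  by_cases haw : a ≤ w
  · exact .inr (ha.wcovBy.sup_eq hb.wcovBy (h.ne hab) ▸ sup_le haw hbw)
  by_cases hcw : c ≤ w
  · exact .inr (hb.wcovBy.sup_eq hc.wcovBy (h.ne hbc) ▸ sup_le hbw hcw)
  exact .inl (h.le_of_between (h.of_ge_right hab hbw haw) (h.of_ge_left hbc hbw hcw) ha.le hc.le)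

end CovBy

/-- Every element has at most two upper covers. Slim semimodular lattices with a conjugate order
have this property. -/
def HasAtMostTwoUpperCovers (L : Type*) [PartialOrder L] : Prop :=
  ∀ ⦃p a b c : L⦄, p ⋖ a → p ⋖ b → p ⋖ c → a ≠ b → c = a ∨ c = b

section Slim

variable {L : Type*} [Lattice L] [IsWeakUpperModularLattice L] {lam : L → L → Prop}

theorem IsSlimLattice.not_covBy_of_between (hL : IsSlimLattice L) (h : IsConjugateOrder lam)
    {p a b c : L} (ha : p ⋖ a) (hb : p ⋖ b) (hab : lam a b) (hbc : lam b c) : ¬ p ⋖ c := by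
  intro hc
  have nab : a ≠ b := h.ne hab
  have nbc : b ≠ c := h.ne hbc
  have nac : a ≠ c := h.ne (h.trans hab hbc)
  have hb_le : b ≤ a ⊔ c := h.le_of_between hab hbc le_sup_left le_sup_right
  have sup_ab : a ⊔ b = a ⊔ c :=
    ((covBy_sup_of_covBy_of_covBy ha hc nac).eq_or_eq le_sup_left
      (sup_le le_sup_left hb_le)).resolve_left (covBy_sup_of_covBy_of_covBy ha hb nab).ne'
  have sup_bc : b ⊔ c = a ⊔ c := by
    rw [sup_comm b, sup_comm a] at *
    exact ((covBy_sup_of_covBy_of_covBy hc ha nac.symm).eq_or_eq le_sup_left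
      (sup_le le_sup_left hb_le)).resolve_left (covBy_sup_of_covBy_of_covBy hc hb nbc.symm).ne'
  have inf_eq : ∀ {u v : L}, p ⋖ u → p ⋖ v → u ≠ v → u ⊓ v = p := fun hu hv huv =>
    hu.wcovBy.inf_eq hv.wcovBy huv
  exact hL ⟨a, b, c, nab, nbc, nac, (inf_eq ha hb nab).trans (inf_eq hb hc nbc).symm,
    (inf_eq hb hc nbc).trans (inf_eq ha hc nac).symm, sup_ab.trans sup_bc.symm, sup_bc⟩

theorem IsSlimLattice.hasAtMostTwoUpperCovers (hL : IsSlimLattice L) (h : IsConjugateOrder lam) :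
    HasAtMostTwoUpperCovers L := by
  intro p a b c ha hb hc hab
  by_contra! hne
  have comparable : ∀ {x y : L}, p ⋖ x → p ⋖ y → x ≠ y → lam x y ∨ lam y x := fun hx hy hxy =>
    h.total (not_le_of_covBy_of_covBy_left hx hy hxy)
      (not_le_of_covBy_of_covBy_left hy hx hxy.symm)
  wlog lab : lam a b generalizing a b
  · exact this hb ha hab.symm hne.symm ((comparable ha hb hab).resolve_left lab)
  rcases comparable hc ha hne.1 with lca | lac
  · exact hL.not_covBy_of_between h hc ha lca lab hb
  rcases comparable hc hb hne.2 with lcb | lbc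
  · exact hL.not_covBy_of_between h ha hc lac lcb hb
  · exact hL.not_covBy_of_between h ha hb lab lbc hc

end Slim

namespace HasAtMostTwoUpperCovers

variable {L : Type*} [Lattice L] [Finite L]

theorem not_le_sup_of_covBy [IsWeakUpperModularLattice L] (hL : HasAtMostTwoUpperCovers L)
    {r e x y : L} (hre : r ⋖ e) (hrx : r ≤ x) (hry : r ≤ y) (hex : ¬ e ≤ x) (hey : ¬ e ≤ y) :
    ¬ e ≤ x ⊔ y := by
  induction r using WellFoundedGT.induction generalizing e with
  | ind r ih =>
    rcases hrx.eq_or_lt with rfl | hrx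
    · rwa [sup_eq_right.mpr hry]
    rcases hry.eq_or_lt with rfl | hry
    · rwa [sup_eq_left.mpr hrx.le]
    obtain ⟨f, hrf, hfx⟩ := exists_covBy_le_of_lt hrx
    obtain ⟨g, hrg, hgy⟩ := exists_covBy_le_of_lt hry
    have hfe : f ≠ e := fun hfe => hex (hfe ▸ hfx)
    have hge : g ≠ e := fun hge => hey (hge ▸ hgy)
    obtain rfl : g = f := (hL hrf hre hrg hfe).resolve_right hge
    have := ih g hrg.lt (covBy_sup_of_covBy_of_covBy hrg hre hge) hfx hgy
      (fun hle => hex (le_sup_right.trans hle)) (fun hle => hey (le_sup_right.trans hle))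
    exact fun hle => this (sup_le (hfx.trans le_sup_left) hle)

theorem le_of_isLeast_Ioi [IsUpperModularLattice L] (hL : HasAtMostTwoUpperCovers L)
    {r e a m s : L} (hre : r ⋖ e) (hra : r ≤ a) (hea : ¬ e ≤ a) (hrm : r ≤ m) (hem : ¬ e ≤ m)
    (hs : IsLeast (Set.Ioi m) s) : a ≤ m := by
  by_contra ham
  have hinf : e ⊓ m = r :=
    (hre.eq_or_eq (le_inf hre.le hrm) inf_le_left).resolve_right fun h => hem (inf_eq_left.mp h)
  have hcov : m ⋖ e ⊔ m := covBy_sup_of_inf_covBy_left (by rwa [hinf])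
  have hse : s = e ⊔ m := (hcov.eq_or_eq hs.1.le (hs.2 hcov.lt)).resolve_left (ne_of_gt hs.1)
  have hsa : s ≤ a ⊔ m := hs.2 (right_lt_sup.mpr ham)
  exact hL.not_le_sup_of_covBy hre hra hrm hea hem ((hse ▸ le_sup_left).trans hsa)

theorem lt_of_inf_le [IsUpperModularLattice L] (hL : HasAtMostTwoUpperCovers L)
    {lam : L → L → Prop} (h : IsConjugateOrder lam) {a b m s : L} (hs : IsLeast (Set.Ioi m) s)
    (hab : a ⊓ b ≤ m) (ham : ¬ a ≤ m) (hbm : ¬ b ≤ m) : m < a ⊔ b := by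
  have nab : ¬ a ≤ b := fun hle => ham (inf_eq_left.mpr hle ▸ hab)
  have nba : ¬ b ≤ a := fun hle => hbm (inf_eq_right.mpr hle ▸ hab)
  obtain ⟨e, he, hea⟩ := exists_covBy_le_of_lt (inf_lt_left.mpr nab)
  obtain ⟨f, hf, hfb⟩ := exists_covBy_le_of_lt (inf_lt_right.mpr nba)
  have heb : ¬ e ≤ b := fun heb => he.lt.not_ge (le_inf hea heb)
  have hfa : ¬ f ≤ a := fun hfa => hf.lt.not_ge (le_inf hfa hfb)
  have hem : e ≤ m := by
    by_contra hem
    exact hbm (hL.le_of_isLeast_Ioi he inf_le_right heb hab hem hs)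
  have hfm : f ≤ m := by
    by_contra hfm
    exact ham (hL.le_of_isLeast_Ioi hf inf_le_left hfa hab hfm hs)
  refine lt_of_le_of_ne ?_ fun hm => ham (hm ▸ le_sup_left)
  rcases h.total nab nba with hlt | hlt
  · exact h.le_of_spanning hlt le_sup_left le_sup_right hea heb hfb hfa hem hfm ham hbm
  · exact h.le_of_spanning hlt le_sup_right le_sup_left hfb hfa hea heb hfm hem hbm ham

end HasAtMostTwoUpperCovers

theorem exists_isLeast_Ioi_of_not_le {L : Type*} [Lattice L] [Finite L] {a b : L} (h : ¬ b ≤ a) :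
    ∃ m s, IsLeast (Set.Ioi m) s ∧ a ≤ m ∧ ¬ b ≤ m ∧ b ≤ s := by
  obtain ⟨m, ham, hm⟩ := Finite.exists_le_maximal (p := fun m => a ≤ m ∧ ¬ b ≤ m) ⟨le_rfl, h⟩
  refine ⟨m, m ⊔ b, ⟨left_lt_sup.mpr hm.prop.2, fun w (hw : m < w) => sup_le hw.le ?_⟩, ham,
    hm.prop.2, le_sup_right⟩
  by_contra hbw
  exact hw.not_ge (hm.le_of_ge ⟨ham.trans hw.le, hbw⟩ hw.le)

/-! ## The congruence that collapses everything strictly below an element -/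

/-- No element `m` with a unique upper cover `s`, where `s` is not strictly below `i`, separates
`a` from `b`. In a finite slim semimodular lattice with a conjugate order this is a congruence, and
its nontrivial classes lie strictly below `i`. -/
def CollapsedBelow {L : Type*} [PartialOrder L] (i a b : L) : Prop :=
  ∀ ⦃m s : L⦄, IsLeast (Set.Ioi m) s → ¬ s < i → (a ≤ m ↔ b ≤ m)

namespace CollapsedBelow

variable {L : Type*} {i a b c : L}

section PartialOrder

variable [PartialOrder L]

theorem refl (i a : L) : CollapsedBelow i a a :=
  fun _ _ _ _ => Iff.rfl

theorem symm (h : CollapsedBelow i a b) : CollapsedBelow i b a :=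
  fun _ _ hs hsi => (h hs hsi).symm

theorem trans (hab : CollapsedBelow i a b) (hbc : CollapsedBelow i b c) : CollapsedBelow i a c :=
  fun _ _ hs hsi => (hab hs hsi).trans (hbc hs hsi)

end PartialOrder

variable [Lattice L]

theorem sup_lt [Finite L] (h : CollapsedBelow i a b) (hab : a ≠ b) : a ⊔ b < i := by
  wlog nba : ¬ b ≤ a generalizing a b
  · exact sup_comm a b ▸ this h.symm hab.symm fun hle => hab (hle.antisymm (not_not.mp nba))
  obtain ⟨m, s, hs, ham, hbm, hbs⟩ := exists_isLeast_Ioi_of_not_le nba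
  by_contra hi
  refine hbm ((h hs fun hsi => hi ?_).mp ham)
  exact (sup_le (ham.trans hs.1.le) hbs).trans_lt hsi

theorem of_middle {lam : L → L → Prop} (h : IsConjugateOrder lam) {x : L} (ha : a ⋖ x)
    (hb : b ⋖ x) (hc : c ⋖ x) (hab : lam a b) (hbc : lam b c) (hxi : x < i) :
    CollapsedBelow i b x := by
  refine fun m s hs hsi => ⟨fun hbm => ?_, hb.le.trans⟩
  rcases h.le_or_ge_of_middle ha hb hc hab hbc hbm with hmx | hxm
  · by_contra hxm
    exact hsi ((hs.2 (lt_of_le_not_ge hmx hxm)).trans_lt hxi)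
  · exact hxm

variable [Finite L] [IsUpperModularLattice L] {lam : L → L → Prop}

theorem inf_right (hL : HasAtMostTwoUpperCovers L) (hlam : IsConjugateOrder lam)
    (h : CollapsedBelow i a b) (c : L) : CollapsedBelow i (a ⊓ c) (b ⊓ c) := by
  suffices ∀ {a b : L}, CollapsedBelow i a b → ∀ {m s : L}, IsLeast (Set.Ioi m) s → ¬ s < i →
      a ⊓ c ≤ m → b ⊓ c ≤ m from
    fun m s hs hsi => ⟨this h hs hsi, this h.symm hs hsi⟩
  intro a b h m s hs hsi ham
  by_contra hbm
  have ha : ¬ a ≤ m := fun ha => hbm (inf_le_left.trans ((h hs hsi).mp ha))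
  have hm : m < a ⊔ b ⊓ c :=
    hL.lt_of_inf_le hlam hs ((inf_le_inf_left a inf_le_right).trans ham) ha hbm
  have hi : a ⊔ b < i := h.sup_lt (by rintro rfl; exact hbm ham)
  exact hsi ((hs.2 (hm.trans_le (sup_le_sup_left inf_le_left a))).trans_lt hi)

end CollapsedBelow

/-- The relation `CollapsedBelow i` as a congruence. -/
def collapseBelow {L : Type*} [Lattice L] [Finite L] [IsUpperModularLattice L]
    (hL : HasAtMostTwoUpperCovers L) {lam : L → L → Prop} (h : IsConjugateOrder lam) (i : L) :
    LatticeCon L where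
  r := CollapsedBelow i
  iseqv := ⟨CollapsedBelow.refl i, CollapsedBelow.symm, CollapsedBelow.trans⟩
  inf {w x y z} hwx hyz := by
    refine (hwx.inf_right hL h y).trans ?_
    rw [inf_comm x, inf_comm x]
    exact hyz.inf_right hL h x
  sup hwx hyz m s hs hsi := by rw [sup_le_iff, sup_le_iff, hwx hs hsi, hyz hs hsi]

/-! ## Covering squares -/

namespace IsCoveringSquare

variable {L : Type*} [Lattice L] {o a b i : L}

theorem ne (h : IsCoveringSquare o a b i) : a ≠ b := h.1

theorem bot_covBy_left (h : IsCoveringSquare o a b i) : o ⋖ a := h.2.1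

theorem bot_covBy_right (h : IsCoveringSquare o a b i) : o ⋖ b := h.2.2.1

theorem left_covBy_top (h : IsCoveringSquare o a b i) : a ⋖ i := h.2.2.2.1

theorem right_covBy_top (h : IsCoveringSquare o a b i) : b ⋖ i := h.2.2.2.2

theorem inf_eq (h : IsCoveringSquare o a b i) : a ⊓ b = o := h.inf_eq_and_sup_eq.1

theorem sup_eq (h : IsCoveringSquare o a b i) : a ⊔ b = i := h.inf_eq_and_sup_eq.2

theorem symm (h : IsCoveringSquare o a b i) : IsCoveringSquare o b a i :=
  ⟨h.ne.symm, h.bot_covBy_right, h.bot_covBy_left, h.right_covBy_top, h.left_covBy_top⟩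

theorem lam_bot {lam : L → L → Prop} (h : IsCoveringSquare o a b i) (hlam : IsConjugateOrder lam)
    (hab : lam a b) {c : L} (hc : c ⋖ a) (hco : c ≠ o) : lam c o := by
  have hcb : ¬ c ≤ b := fun hcb =>
    not_le_of_covBy_of_covBy_right hc h.bot_covBy_left hco (h.inf_eq ▸ le_inf hc.le hcb)
  exact hlam.of_le_right (hlam.of_le_left hab hc.le hcb) h.bot_covBy_right.le
    (not_le_of_covBy_of_covBy_right h.bot_covBy_left hc hco.symm)

end IsCoveringSquare

namespace IsConjugateOrder

variable {L : Type*} [Finite L] {lam : L → L → Prop} {x a b : L}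

theorem exists_adjacent_lower_cover [PartialOrder L] (h : IsConjugateOrder lam) (ha : a ⋖ x)
    (hab : lam a b) :
    ∃ c, c ⋖ x ∧ lam c b ∧ (a = c ∨ lam a c) ∧ ∀ d, d ⋖ x → lam c d → ¬ lam d b := by
  have : IsTrans L (fun u v => lam v u) := ⟨fun _ _ _ huv hvw => h.trans hvw huv⟩
  have : Std.Irrefl (fun u v => lam v u) := ⟨fun u hu => h.ne hu rfl⟩
  have wf : WellFounded (fun u v : L => lam v u) := Finite.wellFounded_of_trans_of_irrefl _
  obtain ⟨c, ⟨hc, hcb, hac⟩, hmin⟩ :=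
    wf.has_min {c | c ⋖ x ∧ lam c b ∧ (a = c ∨ lam a c)} ⟨a, ha, hab, .inl rfl⟩
  refine ⟨c, hc, hcb, hac, fun d hd hcd hdb => hmin d ⟨hd, hdb, .inr ?_⟩ hcd⟩
  rcases hac with rfl | hac
  · exact hcd
  · exact h.trans hac hcd

theorem isCoveringSquare_of_adjacent [Lattice L] [IsWeakUpperModularLattice L]
    (h : IsConjugateOrder lam) (ha : a ⋖ x) (hb : b ⋖ x) (hab : lam a b)
    (hadj : ∀ c, c ⋖ x → lam a c → ¬ lam c b) :
    IsCoveringSquare (a ⊓ b) a b x := by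
  obtain ⟨f, hf, hfa⟩ := exists_covBy_le_of_lt (inf_lt_left.mpr (h.not_le hab))
  obtain ⟨g, hg, hgb⟩ := exists_covBy_le_of_lt (inf_lt_right.mpr (h.not_ge hab))
  have hfb : ¬ f ≤ b := fun hfb => hf.lt.not_ge (le_inf hfa hfb)
  have hga : ¬ g ≤ a := fun hga => hg.lt.not_ge (le_inf hga hgb)
  have hfg : f ≠ g := by rintro rfl; exact hfb hgb
  have hsup : f ⊔ g = x := by
    by_contra hne
    obtain ⟨c, hfgc, hc⟩ := exists_le_covBy_of_lt
      ((sup_le (hfa.trans ha.le) (hgb.trans hb.le)).lt_of_ne hne)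
    obtain ⟨hfc, hgc⟩ := sup_le_iff.mp hfgc
    have compare : ∀ {d : L}, d ⋖ x → c ≠ d → lam c d ∨ lam d c := fun hd hcd =>
      h.total (not_le_of_covBy_of_covBy_right hc hd hcd)
        (not_le_of_covBy_of_covBy_right hd hc hcd.symm)
    rcases compare ha (by rintro rfl; exact hga hgc) with hca | hac
    · exact hga (h.ge_of_between hca hab hgc hgb)
    rcases compare hb (by rintro rfl; exact hfb hfc) with hcb | hbc
    · exact hadj c hc hac hcb
    · exact hfb (h.ge_of_between hab hbc hfa hfc)
  have hfx : f ⋖ x := hsup ▸ covBy_sup_of_covBy_of_covBy hf hg hfg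
  have hgx : g ⋖ x := hsup ▸ sup_comm f g ▸ covBy_sup_of_covBy_of_covBy hg hf hfg.symm
  have hfa : f = a := ((hfx.eq_or_eq hfa ha.le).resolve_right ha.ne).symm
  have hgb : g = b := ((hgx.eq_or_eq hgb hb.le).resolve_right hb.ne).symm
  exact ⟨h.ne hab, hfa ▸ hf, hgb ▸ hg, ha, hb⟩

end IsConjugateOrder

/-- The opposite side. -/
def Side.opp : Side → Side
  | Side.left => Side.right
  | Side.right => Side.left

theorem Side.eq_or_eq_opp (s s' : Side) : s' = s ∨ s' = s.opp := by
  cases s <;> cases s' <;> simp [Side.opp]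

namespace CoveringSquare

variable {L : Type*} [Lattice L] (S : CoveringSquare L)

theorem isCoveringSquare_side (s : Side) :
    IsCoveringSquare S.o (S.side s) (S.side s.opp) S.i := by
  cases s
  · exact S.isCoveringSquare
  · exact S.isCoveringSquare.symm

theorem o_covBy_side (s : Side) : S.o ⋖ S.side s :=
  (S.isCoveringSquare_side s).bot_covBy_left

theorem side_covBy_i (s : Side) : S.side s ⋖ S.i :=
  (S.isCoveringSquare_side s).left_covBy_top

theorem o_lt_i : S.o < S.i :=
  (S.o_covBy_side .left).lt.trans (S.side_covBy_i .left).lt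

theorem IsTight.exists_eq_side {S : CoveringSquare L} (hS : S.IsTight) {c : L} (hc : c ⋖ S.i) :
    ∃ s, c = S.side s := by
  rcases (hS c).mp hc with rfl | rfl
  · exact ⟨.left, rfl⟩
  · exact ⟨.right, rfl⟩

theorem exists_eq_side_of_covBy (hL : HasAtMostTwoUpperCovers L) {c : L} (hc : S.o ⋖ c) :
    ∃ s, c = S.side s := by
  have hS := S.isCoveringSquare
  rcases hL hS.bot_covBy_left hS.bot_covBy_right hc hS.ne with rfl | rfl
  · exact ⟨.left, rfl⟩
  · exact ⟨.right, rfl⟩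

theorem exists_conjugateOrder_lam_side {lam : L → L → Prop} (h : IsConjugateOrder lam) (s : Side) :
    ∃ lam' : L → L → Prop, IsConjugateOrder lam' ∧ lam' (S.side s) (S.side s.opp) := by
  have hsq := S.isCoveringSquare_side s
  rcases h.total
    (not_le_of_covBy_of_covBy_left hsq.bot_covBy_left hsq.bot_covBy_right hsq.ne)
    (not_le_of_covBy_of_covBy_left hsq.bot_covBy_right hsq.bot_covBy_left hsq.ne.symm) with
    hlt | hlt
  · exact ⟨lam, h, hlt⟩
  · exact ⟨_, h.swap, hlt⟩

theorem le_o_of_collapsedBelow [Finite L] (hL : HasAtMostTwoUpperCovers L) {a b : L}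
    (h : CollapsedBelow S.i a b) (ha : a ≤ S.o) : b ≤ S.o := by
  by_contra hb
  obtain ⟨m, s, hs, hom, hbm, -⟩ := exists_isLeast_Ioi_of_not_le hb
  have hsi : s < S.i := by
    by_contra hsi
    exact hbm ((h hs hsi).mp (ha.trans hom))
  rcases hom.eq_or_lt with rfl | hom
  · have hso : s ≤ S.o := (S.isCoveringSquare_side .left).inf_eq ▸
      le_inf (hs.2 (S.o_covBy_side .left).lt) (hs.2 (S.o_covBy_side .right).lt)
    exact lt_irrefl _ (hs.1.trans_le hso)
  · obtain ⟨c, hc, hcm⟩ := exists_covBy_le_of_lt hom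
    obtain ⟨s', rfl⟩ := S.exists_eq_side_of_covBy hL hc
    exact (S.side_covBy_i s').2 (hcm.trans_lt hs.1) hsi

/-! ## The legs of a fork -/

variable {S}

namespace Leg

variable {s : Side} {x y : L}

theorem covBy (h : S.Leg s x y) : y ⋖ x := by
  cases h with
  | base => exact S.o_covBy_side s
  | step h hsq => exact hsq.bot_covBy_left

theorem inf_o (h : S.Leg s x y) : x ⊓ S.o = y := by
  induction h with
  | base => exact inf_eq_right.mpr (S.o_covBy_side s).le
  | step h hsq ih =>
    rw [← hsq.inf_eq, ← ih, ← inf_assoc, inf_eq_left.mpr hsq.left_covBy_top.le]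

theorem le_o (h : S.Leg s x y) : y ≤ S.o := h.inf_o ▸ inf_le_right

theorem not_le_o (h : S.Leg s x y) : ¬ x ≤ S.o := fun hx =>
  h.covBy.ne (h.inf_o.symm.trans (inf_eq_left.mpr hx))

theorem le_side (h : S.Leg s x y) : x ≤ S.side s := by
  induction h with
  | base => exact le_rfl
  | step _ hsq ih => exact hsq.left_covBy_top.le.trans ih

theorem lt_i (h : S.Leg s x y) : x < S.i :=
  h.le_side.trans_lt (S.side_covBy_i s).lt

theorem inf_side_opp (h : S.Leg s x y) : x ⊓ S.side s.opp = y := by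
  refine le_antisymm ?_ (le_inf h.covBy.le (h.le_o.trans (S.o_covBy_side s.opp).le))
  rw [← h.inf_o, ← (S.isCoveringSquare_side s).inf_eq]
  exact le_inf inf_le_left (inf_le_inf_right _ h.le_side)

theorem sup_o (h : S.Leg s x y) : x ⊔ S.o = S.side s :=
  ((S.o_covBy_side s).eq_or_eq le_sup_right
    (sup_le h.le_side (S.o_covBy_side s).le)).resolve_left fun e => h.not_le_o (sup_eq_right.mp e)

theorem not_le_of_opp (h : S.Leg s x y) {x' y' : L} (h' : S.Leg s.opp x' y') : ¬ x ≤ x' :=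
  fun hle => h.not_le_o
    ((S.isCoveringSquare_side s).inf_eq ▸ le_inf h.le_side (hle.trans h'.le_side))

theorem lam_right {lam : L → L → Prop} (hlam : IsConjugateOrder lam)
    (hs : lam (S.side s) (S.side s.opp)) (h : S.Leg s x y) {c : L} (hc : c ⋖ x) (hcy : c ≠ y) :
    lam c y := by
  induction h generalizing c with
  | base => exact (S.isCoveringSquare_side s).lam_bot hlam hs hc hcy
  | step _ hsq ih => exact hsq.lam_bot hlam (ih hsq.left_covBy_top hsq.ne) hc hcy

theorem exists_isCoveringSquare [Finite L] [IsWeakUpperModularLattice L] {lam : L → L → Prop}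
    (hlam : IsConjugateOrder lam) (hs : lam (S.side s) (S.side s.opp)) (h : S.Leg s x y) {c : L}
    (hc : c ⋖ x) (hcy : c ≠ y) : ∃ x' y', IsCoveringSquare y' x' y x ∧ (c = x' ∨ lam c x') := by
  obtain ⟨x', hx', hlt, hcx', hadj⟩ :=
    hlam.exists_adjacent_lower_cover hc (h.lam_right hlam hs hc hcy)
  exact ⟨x', x' ⊓ y, hlam.isCoveringSquare_of_adjacent hx' h.covBy hlt hadj, hcx'⟩

end Leg

/-- One step down a leg: the pair `q` continues the leg from its pair `p`. -/
def LegStep (S : CoveringSquare L) (s : Side) (p q : L × L) : Prop :=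
  S.Leg s p.1 p.2 ∧ IsCoveringSquare q.2 q.1 p.2 p.1

theorem le_of_reflTransGen_legStep {s : Side} {p q : L × L}
    (h : Relation.ReflTransGen (S.LegStep s) p q) : q.1 ≤ p.1 := by
  induction h with
  | refl => exact le_rfl
  | tail _ h ih => exact h.2.left_covBy_top.le.trans ih

theorem not_lam_of_isCoveringSquare (hL : HasAtMostTwoUpperCovers L) {lam : L → L → Prop}
    (hlam : IsConjugateOrder lam) {x y x₁ y₁ x₂ y₂ : L} (h₁ : IsCoveringSquare y₁ x₁ y x)
    (h₂ : IsCoveringSquare y₂ x₂ y x) (hlt : lam x₁ y) : ¬ lam x₂ x₁ := by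
  intro hx
  have hle : y₂ ≤ y₁ := h₁.inf_eq ▸ le_inf
    (hlam.ge_of_between hx hlt h₂.bot_covBy_left.le h₂.bot_covBy_right.le) h₂.bot_covBy_right.le
  obtain rfl : y₁ = y₂ := (h₂.bot_covBy_right.eq_or_eq hle h₁.bot_covBy_right.le).resolve_right
    h₁.bot_covBy_right.ne
  exact (hL h₁.bot_covBy_left h₁.bot_covBy_right h₂.bot_covBy_left h₁.ne).elim (hlam.ne hx) h₂.ne

theorem legStep_rightUnique (hL : HasAtMostTwoUpperCovers L) {lam : L → L → Prop}
    (hlam : IsConjugateOrder lam) (s : Side) : Relator.RightUnique (S.LegStep s) := by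
  obtain ⟨lam, hlam, hs⟩ := S.exists_conjugateOrder_lam_side hlam s
  rintro ⟨x, y⟩ ⟨x₁, y₁⟩ ⟨x₂, y₂⟩ ⟨hl, h₁⟩ ⟨-, h₂⟩
  have lam_right : ∀ {c : L}, c ⋖ x → c ≠ y → lam c y := hl.lam_right hlam hs
  obtain rfl : x₁ = x₂ := by
    by_contra hne
    rcases hlam.total
      (not_le_of_covBy_of_covBy_right h₁.left_covBy_top h₂.left_covBy_top hne)
      (not_le_of_covBy_of_covBy_right h₂.left_covBy_top h₁.left_covBy_top (Ne.symm hne)) with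
      hlt | hlt
    · exact not_lam_of_isCoveringSquare hL hlam h₂ h₁ (lam_right h₂.left_covBy_top h₂.ne) hlt
    · exact not_lam_of_isCoveringSquare hL hlam h₁ h₂ (lam_right h₁.left_covBy_top h₁.ne) hlt
  exact congrArg (Prod.mk x₁) (h₁.inf_eq.symm.trans h₂.inf_eq)

namespace Leg

variable {s : Side} {x y x' y' : L}

theorem reflTransGen_base (h : S.Leg s x y) :
    Relation.ReflTransGen (S.LegStep s) (S.side s, S.o) (x, y) := by
  induction h with
  | base => exact .refl
  | step h hsq ih => exact ih.tail ⟨h, hsq⟩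

section Chain

variable {lam : L → L → Prop}

theorem le_or_ge (hL : HasAtMostTwoUpperCovers L) (hlam : IsConjugateOrder lam)
    (h : S.Leg s x y) (h' : S.Leg s x' y') : x ≤ x' ∨ x' ≤ x :=
  (Relation.ReflTransGen.total_of_right_unique (legStep_rightUnique hL hlam s)
    h.reflTransGen_base h'.reflTransGen_base).symm.imp
    le_of_reflTransGen_legStep le_of_reflTransGen_legStep

theorem reflTransGen_of_le (hL : HasAtMostTwoUpperCovers L) (hlam : IsConjugateOrder lam)
    (h : S.Leg s x y) (h' : S.Leg s x' y') (hle : x' ≤ x) :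
    Relation.ReflTransGen (S.LegStep s) (x, y) (x', y') := by
  rcases Relation.ReflTransGen.total_of_right_unique (legStep_rightUnique hL hlam s)
    h.reflTransGen_base h'.reflTransGen_base with hr | hr
  · exact hr
  · obtain rfl : x = x' := (le_of_reflTransGen_legStep hr).antisymm hle
    rw [← h.inf_o, h'.inf_o]

theorem le_of_lt_of_isCoveringSquare (hL : HasAtMostTwoUpperCovers L)
    (hlam : IsConjugateOrder lam) (h : S.Leg s x y) (hsq : IsCoveringSquare y' x' y x) {u v : L}
    (hu : S.Leg s u v) (hlt : u < x) : u ≤ x' := by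
  rcases (h.reflTransGen_of_le hL hlam hu hlt.le).cases_head with heq | ⟨p, hp, hpu⟩
  · exact absurd (congrArg Prod.fst heq) hlt.ne'
  · obtain rfl : p = (x', y') := legStep_rightUnique hL hlam s hp ⟨h, hsq⟩
    exact le_of_reflTransGen_legStep hpu

end Chain

variable [Finite L]

theorem exists_of_le_of_le_o (hL : HasAtMostTwoUpperCovers L) (h : S.Leg s x y) {c : L}
    (hyc : y ≤ c) (hco : c ≤ S.o) : ∃ x', S.Leg s x' c := by
  induction h with
  | base => exact ⟨_, hyc.antisymm hco ▸ Leg.base⟩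
  | step h hsq ih =>
    rcases hyc.eq_or_lt with rfl | hyc
    · exact ⟨_, Leg.step h hsq⟩
    obtain ⟨d, hd, hdc⟩ := exists_covBy_le_of_lt hyc
    rcases hL hsq.bot_covBy_left hsq.bot_covBy_right hd hsq.ne with rfl | rfl
    · exact absurd (hdc.trans hco) (Leg.step h hsq).not_le_o
    · exact ih hdc

theorem exists_sup_of_le_o (hL : HasAtMostTwoUpperCovers L) (h : S.Leg s x y) {d : L}
    (hd : d ≤ S.o) : ∃ y', S.Leg s (x ⊔ d) y' := by
  induction h with
  | base => exact ⟨S.o, (sup_eq_left.mpr (hd.trans (S.o_covBy_side s).le)).symm ▸ Leg.base⟩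
  | @step x y x' y' h hsq ih =>
    by_cases hdy : d ≤ y'
    · exact ⟨y', (sup_eq_left.mpr (hdy.trans hsq.bot_covBy_left.le)).symm ▸ Leg.step h hsq⟩
    obtain ⟨c, hc, hcd⟩ := exists_covBy_le_of_lt (left_lt_sup.mpr hdy)
    rcases hL hsq.bot_covBy_left hsq.bot_covBy_right hc hsq.ne with rfl | rfl
    · exact absurd (hcd.trans (sup_le (Leg.step h hsq).le_o hd)) (Leg.step h hsq).not_le_o
    have hsup : x' ⊔ d = x ⊔ d := by
      refine (sup_le_sup_right hsq.left_covBy_top.le d).antisymm (sup_le ?_ le_sup_right)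
      rw [← hsq.sup_eq]
      exact sup_le le_sup_left (hcd.trans (sup_le_sup_right hsq.bot_covBy_left.le d))
    exact hsup ▸ ih

theorem sup_eq_o_of_opp (hL : HasAtMostTwoUpperCovers L) (h : S.Leg s x y)
    (h' : S.Leg s.opp x' y') : y ⊔ y' = S.o := by
  have hle : y ⊔ y' ≤ S.o := sup_le h.le_o h'.le_o
  obtain ⟨u, hu⟩ := h.exists_of_le_of_le_o hL le_sup_left hle
  obtain ⟨v, hv⟩ := h'.exists_of_le_of_le_o hL le_sup_right hle
  generalize y ⊔ y' = c at *
  cases hu with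
  | base => rfl
  | step h hsq =>
    rcases hL hsq.bot_covBy_left hsq.bot_covBy_right hv.covBy hsq.ne with rfl | rfl
    · exact absurd le_rfl ((Leg.step h hsq).not_le_of_opp hv)
    · exact absurd h.le_o hv.not_le_o

theorem sup_eq_i_of_opp (hL : HasAtMostTwoUpperCovers L) (h : S.Leg s x y)
    (h' : S.Leg s.opp x' y') : x ⊔ x' = S.i := by
  have ho : S.o ≤ x ⊔ x' :=
    h.sup_eq_o_of_opp hL h' ▸ sup_le_sup h.covBy.le h'.covBy.le
  refine (sup_le h.lt_i.le h'.lt_i.le).antisymm ?_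
  rw [← (S.isCoveringSquare_side s).sup_eq, ← h.sup_o, ← h'.sup_o]
  exact sup_le (sup_le le_sup_left ho) (sup_le le_sup_right ho)

end Leg

/-- The elements of `L` that are below `o`, on a leg, or equal to `i`. These are the least elements
of `L` above the elements `p ≤ t` of `L[S]`. -/
def lowSet (S : CoveringSquare L) : Set L :=
  {a | a ≤ S.o ∨ a = S.i ∨ ∃ s y, S.Leg s a y}

theorem mem_lowSet_of_le_o {a : L} (ha : a ≤ S.o) : a ∈ S.lowSet := .inl ha

theorem i_mem_lowSet : S.i ∈ S.lowSet := .inr (.inl rfl)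

theorem Leg.mem_lowSet {s : Side} {x y : L} (h : S.Leg s x y) : x ∈ S.lowSet :=
  .inr (.inr ⟨s, y, h⟩)

theorem le_i_of_mem_lowSet {a : L} (ha : a ∈ S.lowSet) : a ≤ S.i := by
  rcases ha with ha | rfl | ⟨s, y, ha⟩
  · exact ha.trans S.o_lt_i.le
  · exact le_rfl
  · exact ha.lt_i.le

variable {lam : L → L → Prop}

theorem Leg.le_of_lt_of_mem_lowSet (hL : HasAtMostTwoUpperCovers L)
    (hlam : IsConjugateOrder lam) {s : Side} {x y x' y' a : L} (h : S.Leg s x y)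
    (hsq : IsCoveringSquare y' x' y x) (ha : a ∈ S.lowSet) (hlt : x' < a) : x ≤ a := by
  rcases ha with ha | rfl | ⟨s', b, h'⟩
  · exact absurd (hlt.le.trans ha) (Leg.step h hsq).not_le_o
  · exact h.lt_i.le
  · rcases Side.eq_or_eq_opp s s' with rfl | rfl
    · by_contra hxa
      have hax : a < x := ((h.le_or_ge hL hlam h').resolve_left hxa).lt_of_not_ge hxa
      exact hlt.not_ge (h.le_of_lt_of_isCoveringSquare hL hlam hsq h' hax)
    · exact absurd hlt.le ((Leg.step h hsq).not_le_of_opp h')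

variable [Finite L]

theorem Leg.sup_mem_lowSet (hL : HasAtMostTwoUpperCovers L) (hlam : IsConjugateOrder lam)
    {s : Side} {x y b : L} (h : S.Leg s x y) (hb : b ∈ S.lowSet) : x ⊔ b ∈ S.lowSet := by
  rcases hb with hb | rfl | ⟨s', y', hb⟩
  · obtain ⟨y', h'⟩ := h.exists_sup_of_le_o hL hb
    exact h'.mem_lowSet
  · exact (sup_eq_right.mpr h.lt_i.le).symm ▸ i_mem_lowSet
  rcases Side.eq_or_eq_opp s s' with rfl | rfl
  · rcases h.le_or_ge hL hlam hb with hle | hle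
    · exact (sup_eq_right.mpr hle).symm ▸ hb.mem_lowSet
    · exact (sup_eq_left.mpr hle).symm ▸ h.mem_lowSet
  · exact (h.sup_eq_i_of_opp hL hb).symm ▸ i_mem_lowSet

theorem sup_mem_lowSet (hL : HasAtMostTwoUpperCovers L) (hlam : IsConjugateOrder lam) {a b : L}
    (ha : a ∈ S.lowSet) (hb : b ∈ S.lowSet) : a ⊔ b ∈ S.lowSet := by
  have hai := le_i_of_mem_lowSet ha
  have hbi := le_i_of_mem_lowSet hb
  rcases ha with hao | rfl | ⟨s, y, ha⟩
  · rcases hb with hbo | rfl | ⟨s, y, hb⟩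
    · exact mem_lowSet_of_le_o (sup_le hao hbo)
    · exact (sup_eq_right.mpr hai).symm ▸ i_mem_lowSet
    · exact sup_comm a b ▸ hb.sup_mem_lowSet hL hlam (mem_lowSet_of_le_o hao)
  · exact (sup_eq_left.mpr hbi).symm ▸ i_mem_lowSet
  · exact ha.sup_mem_lowSet hL hlam hb

variable [IsUpperModularLattice L]

theorem Leg.exists_step_of_lt (hL : HasAtMostTwoUpperCovers L) (hlam : IsConjugateOrder lam)
    {s : Side} {x y b : L} (h : S.Leg s x y) (hbx : b < x) (hbo : ¬ b ≤ S.o) :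
    ∃ x' y', IsCoveringSquare y' x' y x ∧ CollapsedBelow S.i (b ⊓ x') b ∧
      ∀ g ∈ S.lowSet, g ≤ b → g ≤ x' := by
  obtain ⟨lam, hlam, hs⟩ := S.exists_conjugateOrder_lam_side hlam s
  obtain ⟨c, hbc, hc⟩ := exists_le_covBy_of_lt hbx
  obtain ⟨x', y', hsq, hcx'⟩ := h.exists_isCoveringSquare hlam hs hc
    fun hcy => hbo (hbc.trans (hcy ▸ h.le_o))
  refine ⟨x', y', hsq, ?_⟩
  rcases hcx' with rfl | hcx'
  · exact ⟨(inf_eq_left.mpr hbc).symm ▸ .refl _ _, fun g _ hgb => hgb.trans hbc⟩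
  have hx'y : lam x' y := h.lam_right hlam hs hsq.left_covBy_top hsq.ne
  constructor
  · have := (CollapsedBelow.of_middle hlam hc hsq.left_covBy_top h.covBy hcx' hx'y h.lt_i).inf_right
      hL hlam b
    rwa [inf_comm, inf_eq_right.mpr hbx.le] at this
  · rintro g (hgo | rfl | ⟨s', v, hg⟩) hgb
    · exact hlam.ge_of_between hcx' hx'y (hgb.trans hbc)
        (h.inf_o ▸ le_inf (hgb.trans hbx.le) hgo)
    · exact absurd (hgb.trans hbx.le) h.lt_i.not_ge
    · rcases Side.eq_or_eq_opp s' s with rfl | rfl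
      · exact h.le_of_lt_of_isCoveringSquare hL hlam hsq hg (hgb.trans_lt hbx)
      · exact absurd (hgb.trans hbx.le) (hg.not_le_of_opp h)

theorem Leg.exists_isGreatest_lowSet (hL : HasAtMostTwoUpperCovers L)
    (hlam : IsConjugateOrder lam) {s : Side} {x y b : L} (h : S.Leg s x y) (hbx : b ≤ x) :
    ∃ g, IsGreatest (S.lowSet ∩ Set.Iic b) g ∧ CollapsedBelow S.i g b := by
  induction x using WellFoundedLT.induction generalizing y b with
  | ind x ih =>
    by_cases hb : b ∈ S.lowSet
    · exact ⟨b, ⟨⟨hb, le_rfl⟩, fun g hg => hg.2⟩, .refl _ _⟩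
    obtain ⟨x', y', hsq, hcol, hle⟩ := h.exists_step_of_lt hL hlam
      (hbx.lt_of_ne fun hb' => hb (hb' ▸ h.mem_lowSet)) fun hbo => hb (mem_lowSet_of_le_o hbo)
    obtain ⟨g, ⟨⟨hg, hgb⟩, hmax⟩, hgcol⟩ :=
      ih x' hsq.left_covBy_top.lt (h.step hsq) (inf_le_right : b ⊓ x' ≤ x')
    exact ⟨g, ⟨⟨hg, hgb.trans inf_le_left⟩,
      fun g' hg' => hmax ⟨hg'.1, le_inf hg'.2 (hle g' hg'.1 hg'.2)⟩⟩, hgcol.trans hcol⟩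

theorem IsTight.exists_isGreatest_lowSet (hS : S.IsTight) (hL : HasAtMostTwoUpperCovers L)
    (hlam : IsConjugateOrder lam) {a b : L} (ha : a ∈ S.lowSet) (hba : b ≤ a) :
    ∃ g, IsGreatest (S.lowSet ∩ Set.Iic b) g ∧ CollapsedBelow S.i g b := by
  by_cases hb : b ∈ S.lowSet
  · exact ⟨b, ⟨⟨hb, le_rfl⟩, fun g hg => hg.2⟩, .refl _ _⟩
  rcases ha with hao | rfl | ⟨s, y, h⟩
  · exact absurd (mem_lowSet_of_le_o (hba.trans hao)) hb
  · obtain ⟨c, hbc, hc⟩ := exists_le_covBy_of_lt (hba.lt_of_ne fun hi => hb (hi ▸ i_mem_lowSet))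
    obtain ⟨s, rfl⟩ := hS.exists_eq_side hc
    exact Leg.base.exists_isGreatest_lowSet hL hlam hbc
  · exact h.exists_isGreatest_lowSet hL hlam hba

end CoveringSquare

/-! ## The conjugate order of a planar diagram -/

/-- A planar straight-line diagram of a poset, the representation of the elements by points that
`IsPlanarPoset` asks for. -/
structure IsPlanarDiagram {L : Type*} [PartialOrder L] (φ : L → ℝ × ℝ) : Prop where
  injective : Function.Injective φ
  strictMono_snd : StrictMono fun a => (φ a).2
  crossing : ∀ a b c d : L, a ⋖ b → c ⋖ d → (a, b) ≠ (c, d) →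
    ∀ P : ℝ × ℝ, P ∈ segment ℝ (φ a) (φ b) → P ∈ segment ℝ (φ c) (φ d) →
      ∃ e : L, (e = a ∨ e = b) ∧ (e = c ∨ e = d) ∧ P = φ e

/-- The points of the diagram that belong to the interval `[a, b]`. As `c ⩿ d` allows `c = d`,
these are the points on the edges together with the vertices. -/
def diagramPoints {L : Type*} [PartialOrder L] (φ : L → ℝ × ℝ) (a b : L) : Set (ℝ × ℝ) :=
  {P | ∃ c d, a ≤ c ∧ c ⩿ d ∧ d ≤ b ∧ P ∈ segment ℝ (φ c) (φ d)}

theorem diagramPoints_mono {L : Type*} [PartialOrder L] {φ : L → ℝ × ℝ} {a b a' b' : L}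
    (ha : a' ≤ a) (hb : b ≤ b') : diagramPoints φ a b ⊆ diagramPoints φ a' b' :=
  fun _ ⟨c, d, hac, hcd, hdb, hP⟩ => ⟨c, d, ha.trans hac, hcd, hdb.trans hb, hP⟩

/-- A path from the vertex `a` up to the vertex `b` within the interval `[a, b]` of the diagram,
given by the abscissa `F s` of its point at height `s`. Only the values of `F` between the heights
of `a` and `b` matter. -/
structure IsPath {L : Type*} [PartialOrder L] (φ : L → ℝ × ℝ) (a b : L) (F : ℝ → ℝ) : Prop where
  continuous : Continuous F
  apply_source : F (φ a).2 = (φ a).1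
  apply_target : F (φ b).2 = (φ b).1
  mem_diagramPoints : ∀ s ∈ Set.Icc (φ a).2 (φ b).2, (F s, s) ∈ diagramPoints φ a b

/-- A path from the bottom to the top of the diagram through the vertex `v`. -/
structure IsTrace {L : Type*} [PartialOrder L] [BoundedOrder L] (φ : L → ℝ × ℝ) (v : L)
    (F : ℝ → ℝ) : Prop where
  below : IsPath φ ⊥ v F
  above : IsPath φ v ⊤ F

theorem exists_continuous_concat {F G : ℝ → ℝ} (hF : Continuous F) (hG : Continuous G) {y : ℝ}
    (hy : F y = G y) :
    ∃ H : ℝ → ℝ, Continuous H ∧ Set.EqOn H F (Set.Iic y) ∧ Set.EqOn H G (Set.Ici y) := by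
  refine ⟨fun s => if s ≤ y then F s else G s,
    Continuous.if_le hF hG continuous_id continuous_const ?_, fun s hs => if_pos hs,
    fun s hs => ?_⟩
  · rintro s rfl
    exact hy
  · rcases (Set.mem_Ici.mp hs).eq_or_lt with rfl | hlt
    · exact (if_pos le_rfl).trans hy
    · exact if_neg hlt.not_ge

namespace IsPath

variable {L : Type*} [PartialOrder L] {φ : L → ℝ × ℝ} {a b c : L} {F G H : ℝ → ℝ}

theorem congr (hF : IsPath φ a b F) (hH : Continuous H)
    (heq : Set.EqOn H F (Set.uIcc (φ a).2 (φ b).2)) : IsPath φ a b H where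
  continuous := hH
  apply_source := (heq Set.left_mem_uIcc).trans hF.apply_source
  apply_target := (heq Set.right_mem_uIcc).trans hF.apply_target
  mem_diagramPoints s hs := by
    rw [heq (Set.Icc_subset_uIcc hs)]
    exact hF.mem_diagramPoints s hs

theorem trans (hab : a ≤ b) (hbc : b ≤ c) (hF : IsPath φ a b F) (hF' : IsPath φ b c F) :
    IsPath φ a c F where
  continuous := hF.continuous
  apply_source := hF.apply_source
  apply_target := hF'.apply_target
  mem_diagramPoints s hs := by
    rcases le_total s (φ b).2 with hsb | hbs
    · exact diagramPoints_mono le_rfl hbc (hF.mem_diagramPoints s ⟨hs.1, hsb⟩)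
    · exact diagramPoints_mono hab le_rfl (hF'.mem_diagramPoints s ⟨hbs, hs.2⟩)

theorem exists_concat (hab : (φ a).2 ≤ (φ b).2) (hF : IsPath φ a b F) (hG : IsPath φ b c G) :
    ∃ H : ℝ → ℝ, IsPath φ a b H ∧ Set.EqOn H G (Set.Ici (φ b).2) := by
  obtain ⟨H, hH, heqF, heqG⟩ := exists_continuous_concat hF.continuous hG.continuous
    (hF.apply_target.trans hG.apply_source.symm)
  refine ⟨H, hF.congr hH (heqF.mono ?_), heqG⟩
  rw [Set.uIcc_of_le hab]
  exact Set.Icc_subset_Iic_self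

theorem congr_of_eqOn_Ici (hab : (φ a).2 ≤ (φ b).2) (hF : IsPath φ a b F) (hH : Continuous H)
    {y : ℝ} (hy : y ≤ (φ a).2) (heq : Set.EqOn H F (Set.Ici y)) : IsPath φ a b H :=
  hF.congr hH (heq.mono (by
    rw [Set.uIcc_of_le hab]
    exact Set.Icc_subset_Ici_self.trans (Set.Ici_subset_Ici.mpr hy)))

end IsPath

namespace IsPlanarDiagram

variable {L : Type*} [PartialOrder L] {φ : L → ℝ × ℝ} {a b c d : L} {F G : ℝ → ℝ} {s s' : ℝ}

theorem snd_le_snd (h : IsPlanarDiagram φ) (hab : a ≤ b) : (φ a).2 ≤ (φ b).2 :=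
  h.strictMono_snd.monotone hab

theorem exists_isPath_of_covBy (h : IsPlanarDiagram φ) (hab : a ⋖ b) :
    ∃ F : ℝ → ℝ, IsPath φ a b F := by
  have hpos : 0 < (φ b).2 - (φ a).2 := sub_pos.mpr (h.strictMono_snd hab.lt)
  refine ⟨fun s => (φ a).1 + (s - (φ a).2) / ((φ b).2 - (φ a).2) * ((φ b).1 - (φ a).1),
    by fun_prop, by simp, by field_simp; ring, fun s hs => ⟨a, b, le_rfl, hab.wcovBy, le_rfl, ?_⟩⟩
  rw [segment_eq_image']
  refine ⟨(s - (φ a).2) / ((φ b).2 - (φ a).2),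
    ⟨div_nonneg (sub_nonneg.mpr hs.1) hpos.le, (div_le_one hpos).mpr (by linarith [hs.2])⟩,
    Prod.ext rfl ?_⟩
  simp only [Prod.snd_add, Prod.smul_snd, Prod.snd_sub, smul_eq_mul]
  field_simp
  ring

theorem exists_isPath [Finite L] (h : IsPlanarDiagram φ) (hab : a ≤ b) :
    ∃ F : ℝ → ℝ, IsPath φ a b F := by
  induction a using WellFoundedGT.induction with
  | ind a ih =>
  rcases hab.eq_or_lt with rfl | hlt
  · refine ⟨fun _ => (φ a).1, continuous_const, rfl, rfl, fun s hs => ?_⟩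
    obtain rfl : s = (φ a).2 := le_antisymm hs.2 hs.1
    exact ⟨a, a, le_rfl, .rfl, le_rfl, left_mem_segment ℝ _ _⟩
  · obtain ⟨c, hac, hcb⟩ := exists_covBy_le_of_lt hlt
    obtain ⟨F, hF⟩ := h.exists_isPath_of_covBy hac
    obtain ⟨G, hG⟩ := ih c hac.lt hcb
    obtain ⟨H, hH, heq⟩ := hF.exists_concat (h.snd_le_snd hac.le) hG
    exact ⟨H, hH.trans hac.le hcb
      (hG.congr_of_eqOn_Ici (h.snd_le_snd hcb) hH.continuous le_rfl heq)⟩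

theorem exists_isTrace_of_le [BoundedOrder L] [Finite L] (h : IsPlanarDiagram φ) (hab : a ≤ b) :
    ∃ F : ℝ → ℝ, IsTrace φ a F ∧ IsTrace φ b F := by
  obtain ⟨F, hF⟩ := h.exists_isPath (bot_le : ⊥ ≤ a)
  obtain ⟨G, hG⟩ := h.exists_isPath hab
  obtain ⟨H, hH⟩ := h.exists_isPath (le_top : b ≤ ⊤)
  obtain ⟨K, hK, hKH⟩ := hG.exists_concat (h.snd_le_snd hab) hH
  have hK' := hH.congr_of_eqOn_Ici (h.snd_le_snd le_top) hK.continuous le_rfl hKH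
  obtain ⟨M, hM, hMK⟩ := hF.exists_concat (h.snd_le_snd bot_le) hK
  have hMab := hK.congr_of_eqOn_Ici (h.snd_le_snd hab) hM.continuous le_rfl hMK
  have hMb := hK'.congr_of_eqOn_Ici (h.snd_le_snd le_top) hM.continuous (h.snd_le_snd hab) hMK
  exact ⟨M, ⟨hM, hMab.trans hab le_top hMb⟩, ⟨hM.trans bot_le hab hMab, hMb⟩⟩

theorem exists_isTrace [BoundedOrder L] [Finite L] (h : IsPlanarDiagram φ) (a : L) :
    ∃ F : ℝ → ℝ, IsTrace φ a F :=
  (h.exists_isTrace_of_le (le_refl a)).imp fun _ => And.left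

theorem eq_or_eq_of_mem_segment [OrderTop L] [Finite L] (h : IsPlanarDiagram φ) {v : L}
    (hcd : c ⋖ d) (hv : φ v ∈ segment ℝ (φ c) (φ d)) : v = c ∨ v = d := by
  by_contra! hne
  -- Some other edge ends or starts at `v`, and it can meet `[c, d]` only in a common endpoint.
  obtain ⟨x, y, hxy, hvxy, hedges⟩ :
      ∃ x y, x ⋖ y ∧ φ v ∈ segment ℝ (φ x) (φ y) ∧ (x, y) ≠ (c, d) := by
    rcases (le_top : v ≤ ⊤).eq_or_lt with rfl | hlt
    · obtain ⟨x, -, hx⟩ := exists_le_covBy_of_lt (hcd.lt.trans_le le_top)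
      exact ⟨x, ⊤, hx, right_mem_segment ℝ _ _, fun he => hne.2 (congrArg Prod.snd he)⟩
    · obtain ⟨y, hy, -⟩ := exists_covBy_le_of_lt hlt
      exact ⟨v, y, hy, left_mem_segment ℝ _ _, fun he => hne.1 (congrArg Prod.fst he)⟩
  obtain ⟨e, -, he, hve⟩ := h.crossing _ _ _ _ hxy hcd hedges _ hvxy hv
  obtain rfl := h.injective hve
  exact he.elim hne.1 hne.2

theorem le_of_mem_segment_of_mem_segment [OrderTop L] [Finite L] (h : IsPlanarDiagram φ)
    {c' d' : L} (hcd : c ⩿ d) (hcd' : c' ⩿ d') {P : ℝ × ℝ} (hP : P ∈ segment ℝ (φ c) (φ d))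
    (hP' : P ∈ segment ℝ (φ c') (φ d')) : c ≤ d' := by
  rcases wcovBy_iff_covBy_or_eq.mp hcd with hcov | rfl <;>
    rcases wcovBy_iff_covBy_or_eq.mp hcd' with hcov' | rfl
  · by_cases hedges : (c, d) = (c', d')
    · cases hedges
      exact hcd.le
    · obtain ⟨e, he, he', -⟩ := h.crossing c d c' d' hcov hcov' hedges P hP hP'
      have hce : c ≤ e := by rcases he with rfl | rfl; exacts [le_rfl, hcd.le]
      have hed : e ≤ d' := by rcases he' with rfl | rfl; exacts [hcd'.le, le_rfl]
      exact hce.trans hed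
  · rw [segment_same, Set.mem_singleton_iff] at hP'
    subst hP'
    rcases h.eq_or_eq_of_mem_segment hcov hP with rfl | rfl
    exacts [le_rfl, hcd.le]
  · rw [segment_same, Set.mem_singleton_iff] at hP
    subst hP
    rcases h.eq_or_eq_of_mem_segment hcov' hP' with rfl | rfl
    exacts [hcd'.le, le_rfl]
  · rw [segment_same, Set.mem_singleton_iff] at hP hP'
    exact (h.injective (hP.symm.trans hP')).le

variable [BoundedOrder L] [Finite L]

theorem le_of_isPath_of_isPath (h : IsPlanarDiagram φ) (hF : IsPath φ a ⊤ F)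
    (hG : IsPath φ ⊥ b G) (hs : s ∈ Set.Icc (φ a).2 (φ b).2) (heq : F s = G s) : a ≤ b := by
  obtain ⟨c, d, hac, hcd, -, hP⟩ := hF.mem_diagramPoints s ⟨hs.1, hs.2.trans (h.snd_le_snd le_top)⟩
  obtain ⟨c', d', -, hcd', hdb, hP'⟩ :=
    hG.mem_diagramPoints s ⟨(h.snd_le_snd bot_le).trans hs.1, hs.2⟩
  rw [heq] at hP
  exact hac.trans ((h.le_of_mem_segment_of_mem_segment hcd hcd' hP hP').trans hdb)

theorem trace_ne (h : IsPlanarDiagram φ) (hab : ¬ a ≤ b) (hba : ¬ b ≤ a) (hF : IsTrace φ a F)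
    (hG : IsTrace φ b G) (hs : s ∈ Set.uIcc (φ a).2 (φ b).2) : F s ≠ G s := by
  intro heq
  rcases Set.mem_uIcc.mp hs with hs | hs
  · exact hab (h.le_of_isPath_of_isPath hF.above hG.below hs heq)
  · exact hba (h.le_of_isPath_of_isPath hG.above hF.below hs heq.symm)

theorem trace_lt_trace (h : IsPlanarDiagram φ) (hab : ¬ a ≤ b) (hba : ¬ b ≤ a)
    (hF : IsTrace φ a F) (hG : IsTrace φ b G) (hs : s ∈ Set.uIcc (φ a).2 (φ b).2)
    (hs' : s' ∈ Set.uIcc (φ a).2 (φ b).2) (hlt : F s < G s) : F s' < G s' := by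
  by_contra! hge
  have hcont : ContinuousOn (fun u => G u - F u) (Set.uIcc s s') :=
    (hG.below.continuous.sub hF.below.continuous).continuousOn
  have hzero : (0 : ℝ) ∈ Set.uIcc (G s - F s) (G s' - F s') :=
    Set.mem_uIcc_of_ge (sub_nonpos.mpr hge) (sub_pos.mpr hlt).le
  obtain ⟨u, hu, hu0⟩ := intermediate_value_uIcc hcont hzero
  exact h.trace_ne hab hba hF hG (Set.uIcc_subset_uIcc hs hs' hu) (sub_eq_zero.mp hu0).symm

end IsPlanarDiagram

/-- The vertex `a` is incomparable to `b` and to the left of `b`: some path through `a` from the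
bottom to the top of the diagram passes `b` on its left. -/
def LeftOf {L : Type*} [PartialOrder L] [BoundedOrder L] (φ : L → ℝ × ℝ) (a b : L) : Prop :=
  ¬ a ≤ b ∧ ¬ b ≤ a ∧ ∃ F, IsTrace φ a F ∧ F (φ b).2 < (φ b).1

theorem mem_uIcc_or_mem_uIcc_or_mem_uIcc {α : Type*} [LinearOrder α] (x y z : α) :
    x ∈ Set.uIcc y z ∨ y ∈ Set.uIcc z x ∨ z ∈ Set.uIcc x y := by
  simp only [Set.mem_uIcc]
  grind

namespace IsPlanarDiagram

variable {L : Type*} [PartialOrder L] [BoundedOrder L] [Finite L] {φ : L → ℝ × ℝ} {a b c : L}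
  {F G : ℝ → ℝ}

theorem trace_lt_trace_of_leftOf (h : IsPlanarDiagram φ) (hab : LeftOf φ a b) (hF : IsTrace φ a F)
    (hG : IsTrace φ b G) {s : ℝ} (hs : s ∈ Set.uIcc (φ a).2 (φ b).2) : F s < G s := by
  obtain ⟨hnle, hnge, F', hF', hF'b⟩ := hab
  have hF'a : F' (φ a).2 < G (φ a).2 := by
    refine h.trace_lt_trace hnle hnge hF' hG Set.right_mem_uIcc Set.left_mem_uIcc ?_
    rwa [hG.below.apply_target]
  refine h.trace_lt_trace hnle hnge hF hG Set.left_mem_uIcc hs ?_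
  rwa [hF.below.apply_target, ← hF'.below.apply_target]

theorem trace_lt_fst_of_leftOf (h : IsPlanarDiagram φ) (hab : LeftOf φ a b) (hF : IsTrace φ a F) :
    F (φ b).2 < (φ b).1 := by
  obtain ⟨G, hG⟩ := h.exists_isTrace b
  rw [← hG.below.apply_target]
  exact h.trace_lt_trace_of_leftOf hab hF hG Set.right_mem_uIcc

theorem fst_lt_trace_of_leftOf (h : IsPlanarDiagram φ) (hab : LeftOf φ a b) (hG : IsTrace φ b G) :
    (φ a).1 < G (φ a).2 := by
  obtain ⟨F, hF⟩ := h.exists_isTrace a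
  rw [← hF.below.apply_target]
  exact h.trace_lt_trace_of_leftOf hab hF hG Set.left_mem_uIcc

theorem leftOf_or_leftOf (h : IsPlanarDiagram φ) (hab : ¬ a ≤ b) (hba : ¬ b ≤ a) :
    LeftOf φ a b ∨ LeftOf φ b a := by
  obtain ⟨F, hF⟩ := h.exists_isTrace a
  obtain ⟨G, hG⟩ := h.exists_isTrace b
  rcases lt_trichotomy (F (φ b).2) (φ b).1 with hlt | heq | hgt
  · exact .inl ⟨hab, hba, F, hF, hlt⟩
  · exact absurd (heq.trans hG.below.apply_target.symm)
      (h.trace_ne hab hba hF hG Set.right_mem_uIcc)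
  · refine .inr ⟨hba, hab, G, hG, ?_⟩
    rw [← hF.below.apply_target]
    refine h.trace_lt_trace hba hab hG hF Set.left_mem_uIcc Set.right_mem_uIcc ?_
    rwa [hG.below.apply_target]

theorem not_leftOf_of_mem_uIcc (h : IsPlanarDiagram φ) (hab : LeftOf φ a b) (hbc : LeftOf φ b c)
    (hb : (φ b).2 ∈ Set.uIcc (φ c).2 (φ a).2) : ¬ LeftOf φ c a := by
  intro hca
  obtain ⟨F, hF⟩ := h.exists_isTrace a
  obtain ⟨G, hG⟩ := h.exists_isTrace c
  have hFG : F (φ b).2 < G (φ b).2 :=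
    (h.trace_lt_fst_of_leftOf hab hF).trans (h.fst_lt_trace_of_leftOf hbc hG)
  exact lt_asymm hFG (h.trace_lt_trace_of_leftOf hca hG hF hb)

theorem not_leftOf_of_leftOf_of_leftOf (h : IsPlanarDiagram φ) (hab : LeftOf φ a b)
    (hbc : LeftOf φ b c) : ¬ LeftOf φ c a := fun hca => by
  rcases mem_uIcc_or_mem_uIcc_or_mem_uIcc (φ a).2 (φ b).2 (φ c).2 with ha | hb | hc
  · exact h.not_leftOf_of_mem_uIcc hca hab ha hbc
  · exact h.not_leftOf_of_mem_uIcc hab hbc hb hca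
  · exact h.not_leftOf_of_mem_uIcc hbc hca hc hab

theorem leftOf_trans (h : IsPlanarDiagram φ) (hab : LeftOf φ a b) (hbc : LeftOf φ b c) :
    LeftOf φ a c := by
  by_cases hac : a ≤ c
  · obtain ⟨F, hFa, hFc⟩ := h.exists_isTrace_of_le hac
    exact absurd (h.fst_lt_trace_of_leftOf hbc hFc) (h.trace_lt_fst_of_leftOf hab hFa).not_gt
  by_cases hca : c ≤ a
  · obtain ⟨F, hFc, hFa⟩ := h.exists_isTrace_of_le hca
    exact absurd (h.fst_lt_trace_of_leftOf hbc hFc) (h.trace_lt_fst_of_leftOf hab hFa).not_gt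
  exact (h.leftOf_or_leftOf hac hca).resolve_right (h.not_leftOf_of_leftOf_of_leftOf hab hbc)

theorem isConjugateOrder (h : IsPlanarDiagram φ) : IsConjugateOrder (LeftOf φ) where
  trans := h.leftOf_trans
  not_le hab := hab.1
  not_ge hab := hab.2.1
  total := h.leftOf_or_leftOf

end IsPlanarDiagram

theorem IsPlanarPoset.exists_isConjugateOrder {L : Type*} [PartialOrder L] [BoundedOrder L]
    (hL : IsPlanarPoset L) : ∃ lam : L → L → Prop, IsConjugateOrder lam := by
  obtain ⟨_, φ, hinj, hlt, hcross⟩ := hL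
  exact ⟨_, IsPlanarDiagram.isConjugateOrder ⟨hinj, fun a b => hlt a b, hcross⟩⟩

/-! ## The order of the fork extension -/

namespace CoveringSquare

variable {L : Type*} [Lattice L] {S : CoveringSquare L}

namespace Fork

/-- The least element of `L` above an element of `L[S]`. -/
def shadow : S.Fork → L
  | old a => a
  | t => S.i
  | z _ x _ _ => x

/-- The elements of `L[S]` that are not below `t`. -/
def IsHigh : S.Fork → Prop
  | old a => ¬ a ≤ S.o
  | t => False
  | z _ _ _ _ => False

/-- The embedding of `L[S]` into the product of `L` with the chain `Prop`, which induces the order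
of `L[S]`. -/
def code (p : S.Fork) : L × Prop := (p.shadow, p.IsHigh)

theorem IsHigh.eq_old {p : S.Fork} (hp : p.IsHigh) : p = old p.shadow := by
  cases p with
  | old a => rfl
  | t => exact hp.elim
  | z s x y h => exact hp.elim

theorem IsHigh.not_le_o {p : S.Fork} (hp : p.IsHigh) : ¬ p.shadow ≤ S.o := by
  rw [hp.eq_old] at hp
  exact hp

theorem shadow_mem_lowSet {p : S.Fork} (hp : ¬ p.IsHigh) : p.shadow ∈ S.lowSet := by
  cases p with
  | old a => exact mem_lowSet_of_le_o (not_not.mp hp)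
  | t => exact i_mem_lowSet
  | z s x y h => exact h.mem_lowSet

theorem exists_shadow_eq {a : L} (ha : a ∈ S.lowSet) :
    ∃ p : S.Fork, p.shadow = a ∧ ¬ p.IsHigh := by
  rcases ha with ha | rfl | ⟨s, y, h⟩
  · exact ⟨old a, rfl, not_not.mpr ha⟩
  · exact ⟨t, rfl, id⟩
  · exact ⟨z s a y h, rfl, id⟩

theorem code_injective : Function.Injective (code : S.Fork → L × Prop) := by
  intro p q hpq
  obtain ⟨hsh, hhigh⟩ := Prod.ext_iff.mp hpq
  replace hhigh := iff_of_eq hhigh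
  rcases p with a | _ | ⟨s, x, y, h⟩ <;> rcases q with b | _ | ⟨s', x', y', h'⟩ <;>
    simp only [code, shadow, IsHigh, iff_false, false_iff, not_not] at hsh hhigh
  · rw [hsh]
  · exact absurd (hsh ▸ hhigh) S.o_lt_i.not_ge
  · exact absurd (hsh ▸ hhigh) h'.not_le_o
  · exact absurd (hsh ▸ hhigh) S.o_lt_i.not_ge
  · rfl
  · exact absurd hsh h'.lt_i.ne'
  · exact absurd (hsh ▸ hhigh) h.not_le_o
  · exact absurd hsh h.lt_i.ne
  · subst hsh
    obtain rfl : y = y' := h.inf_o.symm.trans h'.inf_o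
    rcases Side.eq_or_eq_opp s s' with rfl | rfl
    · rfl
    · exact absurd le_rfl (h.not_le_of_opp h')

theorem code_le_code_old {p : S.Fork} {a : L} : p.code ≤ (old a : S.Fork).code ↔ p.shadow ≤ a :=
  ⟨And.left, fun hle => ⟨hle, fun hp ha => IsHigh.not_le_o hp (hle.trans ha)⟩⟩

theorem code_le_code_of_not_isHigh {p q : S.Fork} (hp : ¬ p.IsHigh) :
    p.code ≤ q.code ↔ p.shadow ≤ q.shadow :=
  ⟨And.left, fun hle => ⟨hle, fun h => absurd h hp⟩⟩

end Fork

theorem ForkStep.code_le {p q : S.Fork} (h : S.ForkStep p q) : p.code ≤ q.code := by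
  cases h with
  | old h => exact Fork.code_le_code_old.mpr h
  | t_i => exact Fork.code_le_code_old.mpr le_rfl
  | z_t s => exact (Fork.code_le_code_of_not_isHigh id).mpr Leg.base.lt_i.le
  | y_z s h => exact ⟨h.covBy.le, absurd h.le_o⟩
  | z_x s h => exact Fork.code_le_code_old.mpr le_rfl
  | z_z s h hsq => exact (Fork.code_le_code_of_not_isHigh id).mpr hsq.left_covBy_top.le

theorem ForkLE.code_le {p q : S.Fork} (h : S.ForkLE p q) : p.code ≤ q.code := by
  induction h with
  | refl => exact le_rfl
  | tail _ h ih => exact ih.trans h.code_le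

theorem forkLE_z_of_reflTransGen {s : Side} {p q : L × L} (hp : S.Leg s p.1 p.2)
    (h : Relation.ReflTransGen (S.LegStep s) p q) :
    ∃ hq : S.Leg s q.1 q.2, S.ForkLE (Fork.z s q.1 q.2 hq) (Fork.z s p.1 p.2 hp) := by
  induction h with
  | refl => exact ⟨hp, .refl⟩
  | tail _ h ih => exact ⟨Leg.step h.1 h.2, .head (ForkStep.z_z s h.1 h.2) ih.2⟩

theorem forkLE_z_t {s : Side} {x y : L} (h : S.Leg s x y) : S.ForkLE (Fork.z s x y h) Fork.t := by
  obtain ⟨_, hle⟩ := forkLE_z_of_reflTransGen Leg.base h.reflTransGen_base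
  exact hle.tail (ForkStep.z_t s)

theorem forkLE_iff (hL : HasAtMostTwoUpperCovers L) {lam : L → L → Prop}
    (hlam : IsConjugateOrder lam) {p q : S.Fork} : S.ForkLE p q ↔ p.code ≤ q.code := by
  refine ⟨ForkLE.code_le, fun ⟨hle, hhigh⟩ => ?_⟩
  rcases p with a | _ | ⟨s, x, y, h⟩ <;> rcases q with b | _ | ⟨s', x', y', h'⟩ <;>
    simp only [Fork.code, Fork.shadow, Fork.IsHigh, le_Prop_eq, imp_false, not_not] at hle hhigh
  · exact .single (.old hle)
  · exact .head (.old hhigh) (.head (.y_z Side.left Leg.base) (.single (.z_t Side.left)))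
  · exact .head (.old (h'.inf_o ▸ le_inf hle hhigh)) (.single (.y_z s' h'))
  · exact .head .t_i (.single (.old hle))
  · exact .refl
  · exact absurd hle h'.lt_i.not_ge
  · exact .head (.z_x s h) (.single (.old hle))
  · exact forkLE_z_t h
  · rcases Side.eq_or_eq_opp s s' with rfl | rfl
    · exact (forkLE_z_of_reflTransGen h' (h'.reflTransGen_of_le hL hlam h hle)).2
    · exact absurd hle (h.not_le_of_opp h')

namespace Fork

variable [Finite L] {lam : L → L → Prop}

theorem exists_code_eq_sup (hL : HasAtMostTwoUpperCovers L) (hlam : IsConjugateOrder lam)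
    (p q : S.Fork) : ∃ r : S.Fork, r.code = p.code ⊔ q.code := by
  by_cases hpq : p.IsHigh ∨ q.IsHigh
  · refine ⟨old (p.shadow ⊔ q.shadow), Prod.ext rfl (propext (iff_of_true (fun hle => ?_) hpq))⟩
    exact hpq.elim (fun hp => hp.not_le_o (le_sup_left.trans hle))
      (fun hq => hq.not_le_o (le_sup_right.trans hle))
  · obtain ⟨hp, hq⟩ := not_or.mp hpq
    obtain ⟨r, hr, hr'⟩ :=
      exists_shadow_eq (sup_mem_lowSet hL hlam (shadow_mem_lowSet hp) (shadow_mem_lowSet hq))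
    exact ⟨r, Prod.ext hr (propext (iff_of_false hr' hpq))⟩

theorem exists_code_le_iff_le_inf [IsUpperModularLattice L] (hL : HasAtMostTwoUpperCovers L)
    (hlam : IsConjugateOrder lam) (hS : S.IsTight) (p q : S.Fork) :
    ∃ r : S.Fork, (∀ c : S.Fork, c.code ≤ p.code ⊓ q.code ↔ c.code ≤ r.code) ∧
      CollapsedBelow S.i r.shadow (p.shadow ⊓ q.shadow) := by
  by_cases hpq : p.IsHigh ∧ q.IsHigh
  · refine ⟨old (p.shadow ⊓ q.shadow), fun c => ?_, .refl _ _⟩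
    rw [hpq.1.eq_old, hpq.2.eq_old, le_inf_iff]
    simp only [code_le_code_old, shadow, le_inf_iff]
  · obtain ⟨g, ⟨⟨hg, hgle⟩, hmax⟩, hcol⟩ :
        ∃ g, IsGreatest (S.lowSet ∩ Set.Iic (p.shadow ⊓ q.shadow)) g ∧
          CollapsedBelow S.i g (p.shadow ⊓ q.shadow) := by
      rcases not_and_or.mp hpq with hp | hq
      · exact hS.exists_isGreatest_lowSet hL hlam (shadow_mem_lowSet hp) inf_le_left
      · exact hS.exists_isGreatest_lowSet hL hlam (shadow_mem_lowSet hq) inf_le_right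
    obtain ⟨r, rfl, hr⟩ := exists_shadow_eq hg
    refine ⟨r, fun c => ⟨fun hc => ?_, fun hc => ?_⟩, hcol⟩
    · have hc' : ¬ c.IsHigh := fun h => hpq (hc.2 h)
      exact (code_le_code_of_not_isHigh hc').mpr (hmax ⟨shadow_mem_lowSet hc', hc.1⟩)
    · exact ⟨hc.1.trans hgle, fun h => absurd (hc.2 h) hr⟩

end Fork

/-- The given order of `L[S]` is the one that `Fork.code` induces. -/
def HasForkOrder (S : CoveringSquare L) [LE S.Fork] : Prop :=
  ∀ p q : S.Fork, p ≤ q ↔ p.code ≤ q.code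

theorem exists_lattice_hasForkOrder [Finite L] [IsUpperModularLattice L]
    (hL : HasAtMostTwoUpperCovers L) {lam : L → L → Prop} (hlam : IsConjugateOrder lam)
    (hS : S.IsTight) : ∃ _ : Lattice S.Fork, S.HasForkOrder := by
  let : PartialOrder S.Fork := PartialOrder.lift Fork.code Fork.code_injective
  choose sup hsup using Fork.exists_code_eq_sup hL hlam (S := S)
  choose inf hinf _ using Fork.exists_code_le_iff_le_inf hL hlam hS
  refine ⟨Lattice.ofIsLUBofIsGLB sup inf (fun p q => isLUB_iff_le_iff.mpr fun c => ?_)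
    (fun p q => isGLB_iff_le_iff.mpr fun c => ?_), fun p q => Iff.rfl⟩
  · rw [upperBounds_insert, upperBounds_singleton]
    exact (congrArg (· ≤ c.code) (hsup p q)).to_iff.trans sup_le_iff
  · rw [lowerBounds_insert, lowerBounds_singleton]
    exact (hinf p q c).symm.trans le_inf_iff

namespace HasForkOrder

variable [Lattice S.Fork]

theorem sup_eq (hF : S.HasForkOrder) {p q r : S.Fork} (h : r.code = p.code ⊔ q.code) :
    p ⊔ q = r :=
  eq_of_forall_ge_iff fun c => by rw [sup_le_iff, hF, hF, hF, h, sup_le_iff]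

theorem inf_eq (hF : S.HasForkOrder) {p q r : S.Fork}
    (h : ∀ c : S.Fork, c.code ≤ p.code ⊓ q.code ↔ c.code ≤ r.code) : p ⊓ q = r :=
  eq_of_forall_le_iff fun c => by rw [le_inf_iff, hF, hF, hF, ← h, le_inf_iff]

theorem inf_eq_of_code_eq (hF : S.HasForkOrder) {p q r : S.Fork} (h : r.code = p.code ⊓ q.code) :
    p ⊓ q = r :=
  hF.inf_eq fun c => by rw [h]

theorem le_old_iff (hF : S.HasForkOrder) {p : S.Fork} {a : L} :
    p ≤ Fork.old a ↔ p.shadow ≤ a := by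
  rw [hF, Fork.code_le_code_old]

theorem old_le_old (hF : S.HasForkOrder) {a b : L} :
    (Fork.old a : S.Fork) ≤ Fork.old b ↔ a ≤ b :=
  hF.le_old_iff

theorem le_iff_of_not_isHigh (hF : S.HasForkOrder) {p q : S.Fork} (hp : ¬ p.IsHigh) :
    p ≤ q ↔ p.shadow ≤ q.shadow := by
  rw [hF, Fork.code_le_code_of_not_isHigh hp]

theorem t_le_iff (hF : S.HasForkOrder) {q : S.Fork} : Fork.t ≤ q ↔ S.i ≤ q.shadow :=
  hF.le_iff_of_not_isHigh id

theorem z_le_iff (hF : S.HasForkOrder) {s : Side} {x y : L} {h : S.Leg s x y} {q : S.Fork} :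
    Fork.z s x y h ≤ q ↔ x ≤ q.shadow :=
  hF.le_iff_of_not_isHigh id

theorem old_inf_old (hF : S.HasForkOrder) (a b : L) :
    (Fork.old a : S.Fork) ⊓ Fork.old b = Fork.old (a ⊓ b) :=
  hF.inf_eq fun c => by simp only [le_inf_iff, Fork.code_le_code_old]

theorem old_sup_old (hF : S.HasForkOrder) (a b : L) :
    (Fork.old a : S.Fork) ⊔ Fork.old b = Fork.old (a ⊔ b) :=
  hF.sup_eq (Prod.ext rfl (propext (by
    simp only [Fork.code, Fork.IsHigh, Fork.shadow, sup_le_iff, not_and_or]; rfl)))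

/-- The inclusion of `L` as a sublattice of `L[S]`. -/
def oldHom (hF : S.HasForkOrder) : LatticeHom L S.Fork where
  toFun := Fork.old
  map_sup' a b := (hF.old_sup_old a b).symm
  map_inf' a b := (hF.old_inf_old a b).symm

theorem isHigh_inf (hF : S.HasForkOrder) {p q : S.Fork} :
    (p ⊓ q).IsHigh ↔ p.IsHigh ∧ q.IsHigh ∧ ¬ p.shadow ⊓ q.shadow ≤ S.o := by
  have hl := (hF _ _).mp (inf_le_left : p ⊓ q ≤ p)
  have hr := (hF _ _).mp (inf_le_right : p ⊓ q ≤ q)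
  refine ⟨fun h => ⟨hl.2 h, hr.2 h, fun hle => h.not_le_o ((le_inf hl.1 hr.1).trans hle)⟩, ?_⟩
  rintro ⟨hp, hq, hpq⟩
  rw [hp.eq_old, hq.eq_old, hF.old_inf_old]
  exact hpq

variable [Finite L] {lam : L → L → Prop}

theorem code_sup (hF : S.HasForkOrder) (hL : HasAtMostTwoUpperCovers L)
    (hlam : IsConjugateOrder lam) (p q : S.Fork) : (p ⊔ q).code = p.code ⊔ q.code := by
  obtain ⟨r, hr⟩ := Fork.exists_code_eq_sup hL hlam p q
  rw [hF.sup_eq hr, hr]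

variable [IsUpperModularLattice L]

theorem collapsedBelow_shadow_inf (hF : S.HasForkOrder) (hL : HasAtMostTwoUpperCovers L)
    (hlam : IsConjugateOrder lam) (hS : S.IsTight) (p q : S.Fork) :
    CollapsedBelow S.i (p ⊓ q).shadow (p.shadow ⊓ q.shadow) := by
  obtain ⟨r, hr, hcol⟩ := Fork.exists_code_le_iff_le_inf hL hlam hS p q
  rwa [hF.inf_eq hr]

/-- The congruence of `L[S]` that identifies the elements whose shadows are identified by
`collapseBelow`; in particular, it identifies `t` with `i`. -/
def shadowCon (hF : S.HasForkOrder) (hL : HasAtMostTwoUpperCovers L)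
    (hlam : IsConjugateOrder lam) (hS : S.IsTight) : LatticeCon S.Fork where
  r p q := CollapsedBelow S.i p.shadow q.shadow
  iseqv := (collapseBelow hL hlam S.i).iseqv.comap Fork.shadow
  inf {p p' q q'} h h' :=
    ((hF.collapsedBelow_shadow_inf hL hlam hS p q).trans
      ((collapseBelow hL hlam S.i).inf h h')).trans
        (hF.collapsedBelow_shadow_inf hL hlam hS p' q').symm
  sup {p p' q q'} h h' := by
    have hsup (p q : S.Fork) : (p ⊔ q).shadow = p.shadow ⊔ q.shadow :=
      congrArg Prod.fst (hF.code_sup hL hlam p q)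
    rw [hsup, hsup]
    exact (collapseBelow hL hlam S.i).sup h h'

/-- The refinement of `shadowCon` that separates the high elements from the others. -/
def levelCon (hF : S.HasForkOrder) (hL : HasAtMostTwoUpperCovers L)
    (hlam : IsConjugateOrder lam) (hS : S.IsTight) : LatticeCon S.Fork where
  r p q := (hF.shadowCon hL hlam hS).r p q ∧ (p.IsHigh ↔ q.IsHigh)
  iseqv :=
    ⟨fun p => ⟨(hF.shadowCon hL hlam hS).refl p, Iff.rfl⟩,
      fun h => ⟨(hF.shadowCon hL hlam hS).symm h.1, h.2.symm⟩,
      fun h h' => ⟨(hF.shadowCon hL hlam hS).trans h.1 h'.1, h.2.trans h'.2⟩⟩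
  inf h h' := by
    refine ⟨(hF.shadowCon hL hlam hS).inf h.1 h'.1, ?_⟩
    have hcol := (collapseBelow hL hlam S.i).inf h.1 h'.1
    rw [hF.isHigh_inf, hF.isHigh_inf]
    exact and_congr h.2 (and_congr h'.2 (not_congr
      ⟨S.le_o_of_collapsedBelow hL hcol, S.le_o_of_collapsedBelow hL hcol.symm⟩))
  sup h h' := by
    have hsup (p q : S.Fork) : (p ⊔ q).IsHigh ↔ p.IsHigh ∨ q.IsHigh :=
      iff_of_eq (congrArg Prod.snd (hF.code_sup hL hlam p q))
    refine ⟨(hF.shadowCon hL hlam hS).sup h.1 h'.1, ?_⟩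
    rw [hsup, hsup]
    exact or_congr h.2 h'.2

end HasForkOrder

end CoveringSquare

/-! ## Congruences of finite lattices -/

namespace LatticeCongruence

open LatticeCon

variable {K : Type*} [Lattice K] {c d : LatticeCon K}

theorem gen_le {R : K → K → Prop} (h : ∀ a b, R a b → c.r a b) : gen R ≤ c :=
  sInf_le h

theorem rel_gen {R : K → K → Prop} {a b : K} (h : R a b) : (gen R).r a b := by
  rintro _ ⟨c, hc, rfl⟩
  exact hc a b h

theorem principal_le_iff {a b : K} : principal a b ≤ c ↔ c.r a b :=
  ⟨fun h => h (rel_gen ⟨rfl, rfl⟩), fun h => gen_le (by rintro _ _ ⟨rfl, rfl⟩; exact h)⟩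

theorem rel_principal (a b : K) : (principal a b).r a b :=
  principal_le_iff.mp le_rfl

theorem rel_sup_right {a b : K} (h : c.r a b) (x : K) : c.r (a ⊔ x) (b ⊔ x) :=
  c.sup h (c.refl x)

theorem rel_inf_right {a b : K} (h : c.r a b) (x : K) : c.r (a ⊓ x) (b ⊓ x) :=
  c.inf h (c.refl x)

theorem rel_of_mem_Icc {a b x y : K} (h : c.r a b) (hax : a ≤ x) (hxy : x ≤ y) (hyb : y ≤ b) :
    c.r x y := by
  have := rel_inf_right (rel_sup_right h x) y
  rwa [sup_eq_right.mpr hax, sup_eq_left.mpr (hxy.trans hyb), inf_eq_left.mpr hxy,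
    inf_eq_right.mpr hyb] at this

theorem principal_inf_eq_principal_sup (a b : K) :
    principal (a ⊓ b) a = principal b (a ⊔ b) := by
  refine le_antisymm (principal_le_iff.mpr ?_) (principal_le_iff.mpr ?_)
  · have := rel_inf_right (rel_principal b (a ⊔ b)) a
    rwa [inf_comm b, inf_eq_right.mpr (le_sup_left : a ≤ a ⊔ b)] at this
  · have := rel_sup_right (rel_principal (a ⊓ b) a) b
    rwa [sup_eq_right.mpr inf_le_right] at this

theorem toSetoid_sup_le (c d : LatticeCon K) : (c ⊔ d).toSetoid ≤ c.toSetoid ⊔ d.toSetoid := by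
  have key {f : K → K} (hc : c.toSetoid ≤ c.toSetoid.comap f)
      (hd : d.toSetoid ≤ d.toSetoid.comap f) :
      c.toSetoid ⊔ d.toSetoid ≤ (c.toSetoid ⊔ d.toSetoid).comap f :=
    sup_le (fun _ _ h => (le_sup_left : c.toSetoid ≤ c.toSetoid ⊔ d.toSetoid) (hc h))
      (fun _ _ h => (le_sup_right : d.toSetoid ≤ c.toSetoid ⊔ d.toSetoid) (hd h))
  let e : LatticeCon K :=
    { toSetoid := c.toSetoid ⊔ d.toSetoid
      inf := fun {_ x y _} h h' =>
        Setoid.trans' _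
          (key (f := (· ⊓ y)) (fun _ _ h => c.inf h (c.refl y)) (fun _ _ h => d.inf h (d.refl y)) h)
          (key (f := (x ⊓ ·)) (fun _ _ h => c.inf (c.refl x) h) (fun _ _ h => d.inf (d.refl x) h)
            h')
      sup := fun {_ x y _} h h' =>
        Setoid.trans' _
          (key (f := (· ⊔ y)) (fun _ _ h => c.sup h (c.refl y)) (fun _ _ h => d.sup h (d.refl y)) h)
          (key (f := (x ⊔ ·)) (fun _ _ h => c.sup (c.refl x) h) (fun _ _ h => d.sup (d.refl x) h)
            h') }
  exact (sup_le (le_sup_left : c.toSetoid ≤ _) (le_sup_right : d.toSetoid ≤ _) : c ⊔ d ≤ e)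

theorem toSetoid_le_ker_of_not_rel {p q : K} (hpq : p ⋖ q) (hc : ¬ c.r p q) :
    c.toSetoid ≤ Setoid.ker fun x => (x ⊔ p) ⊓ q := by
  have hf (x : K) : (x ⊔ p) ⊓ q = p ∨ (x ⊔ p) ⊓ q = q :=
    hpq.eq_or_eq (le_inf le_sup_right hpq.le) inf_le_right
  intro x y hxy
  have h := rel_inf_right (rel_sup_right hxy p) q
  change (x ⊔ p) ⊓ q = (y ⊔ p) ⊓ q
  rcases hf x with hx | hx <;> rcases hf y with hy | hy <;> rw [hx, hy] at h ⊢
  · exact absurd h hc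
  · exact absurd (c.symm h) hc

theorem rel_or_rel_of_rel_sup {p q : K} (hpq : p ⋖ q) (h : (c ⊔ d).r p q) :
    c.r p q ∨ d.r p q := by
  by_contra! hne
  have hker : (p ⊔ p) ⊓ q = (q ⊔ p) ⊓ q :=
    sup_le (toSetoid_le_ker_of_not_rel hpq hne.1) (toSetoid_le_ker_of_not_rel hpq hne.2)
      (toSetoid_sup_le c d h)
  rw [sup_idem, inf_eq_left.mpr hpq.le, sup_eq_left.mpr hpq.le, inf_idem] at hker
  exact hpq.ne hker

theorem supIrred_principal {p q : K} (hpq : p ⋖ q) : SupIrred (principal p q) := by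
  refine ⟨fun hmin => hpq.ne ?_, fun c d hcd => ?_⟩
  · exact (hmin bot_le).trans (bot_le (a := ker (LatticeHom.id K))) (rel_principal p q)
  · exact (rel_or_rel_of_rel_sup hpq (hcd.symm ▸ rel_principal p q)).imp
      (fun h => le_antisymm (hcd ▸ le_sup_left) (principal_le_iff.mpr h))
      (fun h => le_antisymm (hcd ▸ le_sup_right) (principal_le_iff.mpr h))

theorem le_of_forall_covBy [Finite K] (h : ∀ p q, p ⋖ q → c.r p q → d.r p q) : c ≤ d := by
  have key (u : K) : ∀ v, u ≤ v → c.r u v → d.r u v := by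
    induction u using WellFoundedGT.induction with
    | ind u ih =>
      intro v huv hc
      rcases huv.eq_or_lt with rfl | huv
      · exact d.refl u
      · obtain ⟨w, huw, hwv⟩ := exists_covBy_le_of_lt huv
        exact d.trans (h u w huw (rel_of_mem_Icc hc le_rfl huw.le hwv))
          (ih w huw.lt v hwv (rel_of_mem_Icc hc huw.le hwv le_rfl))
  intro x y hxy
  exact d.r_inf_sup_iff.mp (key _ _ inf_le_sup (c.r_inf_sup_iff.mpr hxy))

theorem exists_covBy_eq_principal_of_supIrred [Finite K] (hc : SupIrred c) :
    ∃ p q : K, p ⋖ q ∧ c = principal p q := by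
  classical
  have := Fintype.ofFinite K
  let A : Finset (K × K) := {e | e.1 ⋖ e.2 ∧ c.r e.1 e.2}
  have hA : A.sup (fun e => principal e.1 e.2) = c := by
    refine le_antisymm (Finset.sup_le fun e he => ?_) (le_of_forall_covBy fun p q hpq h => ?_)
    · exact principal_le_iff.mpr (Finset.mem_filter.mp he).2.2
    · have hmem : (p, q) ∈ A := Finset.mem_filter.mpr ⟨Finset.mem_univ _, hpq, h⟩
      exact principal_le_iff.mp (Finset.le_sup (f := fun e : K × K => principal e.1 e.2) hmem)
  obtain ⟨e, he, h⟩ := hc.finset_sup_eq hA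
  exact ⟨e.1, e.2, (Finset.mem_filter.mp he).2.1, h.symm⟩

/-- The inverse image of a congruence under a lattice homomorphism; along the inclusion of a
sublattice, it is the restriction of the congruence. -/
def comap {M : Type*} [Lattice M] (f : LatticeHom K M) (c : LatticeCon M) : LatticeCon K where
  toSetoid := c.toSetoid.comap f
  inf h h' := by
    change c.r _ _
    rw [map_inf, map_inf]
    exact c.inf h h'
  sup h h' := by
    change c.r _ _
    rw [map_sup, map_sup]
    exact c.sup h h'

end LatticeCongruence

/-! ## The join-irreducible congruences of the fork extension -/

namespace CoveringSquare.HasForkOrder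

open LatticeCon LatticeCongruence

variable {L : Type*} [Lattice L] {S : CoveringSquare L} [Lattice S.Fork]

theorem minimalExtension_principal (hF : S.HasForkOrder) (a b : L) :
    S.minimalExtension (principal a b) = principal (Fork.old a) (Fork.old b) := by
  refine le_antisymm (gen_le ?_)
    (principal_le_iff.mpr (rel_gen ⟨a, b, rel_principal a b, rfl, rfl⟩))
  rintro _ _ ⟨x, y, hxy, rfl, rfl⟩
  have hle : principal a b ≤ comap hF.oldHom (principal (Fork.old a) (Fork.old b)) :=
    principal_le_iff.mpr (rel_principal (Fork.old a : S.Fork) (Fork.old b))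
  exact hle hxy

theorem t_covBy_i (hF : S.HasForkOrder) : (Fork.t : S.Fork) ⋖ Fork.old S.i := by
  refine covBy_iff_lt_and_eq_or_eq.mpr
    ⟨(hF.le_old_iff.mpr le_rfl).lt_of_ne nofun, fun c htc hci => ?_⟩
  rw [hF.t_le_iff] at htc
  rw [hF.le_old_iff] at hci
  cases c with
  | old c => exact .inr (congrArg Fork.old (hci.antisymm htc))
  | t => exact .inl rfl
  | z s x y h => exact absurd htc h.lt_i.not_ge

theorem covBy_of_old_covBy_old (hF : S.HasForkOrder) {a b : L}
    (hab : (Fork.old a : S.Fork) ⋖ Fork.old b) : a ⋖ b := by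
  have hlt {c d : L} : (Fork.old c : S.Fork) < Fork.old d ↔ c < d :=
    lt_iff_lt_of_le_iff_le' hF.old_le_old hF.old_le_old
  exact ⟨hlt.mp hab.lt, fun _ hac hcb => hab.2 (hlt.mpr hac) (hlt.mpr hcb)⟩

theorem principal_z_x (hF : S.HasForkOrder) {s : Side} {x y : L} (h : S.Leg s x y) :
    principal (Fork.z s x y h) (Fork.old x) = S.gamma := by
  have hinf : (Fork.old x : S.Fork) ⊓ Fork.t = Fork.z s x y h :=
    hF.inf_eq_of_code_eq (Prod.ext (inf_eq_left.mpr h.lt_i.le).symm (inf_bot_eq _).symm)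
  have hsup : (Fork.old x : S.Fork) ⊔ Fork.t = Fork.old S.i :=
    hF.sup_eq (Prod.ext (sup_eq_right.mpr h.lt_i.le).symm
      (propext (iff_of_true S.o_lt_i.not_ge (.inl h.not_le_o))))
  have key := principal_inf_eq_principal_sup (Fork.old x : S.Fork) Fork.t
  rwa [hinf, hsup] at key

theorem principal_z_of_not_isHigh (hF : S.HasForkOrder) {s : Side} {x y : L} (h : S.Leg s x y)
    {q : S.Fork} (hq : ¬ q.IsHigh) (hxq : x ≤ q.shadow) :
    principal (Fork.z s x y h) q = principal (Fork.old x) (Fork.old q.shadow) := by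
  have hinf : q ⊓ Fork.old x = Fork.z s x y h :=
    hF.inf_eq_of_code_eq (Prod.ext (inf_eq_right.mpr hxq).symm
      (propext (iff_of_false id fun hqx => hq hqx.1)))
  have hsup : q ⊔ Fork.old x = Fork.old q.shadow :=
    hF.sup_eq (Prod.ext (sup_eq_left.mpr hxq).symm
      (propext (iff_of_true (fun hqo => h.not_le_o (hxq.trans hqo)) (.inr h.not_le_o))))
  have key := principal_inf_eq_principal_sup q (Fork.old x)
  rwa [hinf, hsup] at key

theorem principal_t_eq_gamma (hF : S.HasForkOrder) {q : S.Fork} (htq : Fork.t ⋖ q) :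
    principal Fork.t q = S.gamma := by
  have hle := hF.t_le_iff.mp htq.le
  cases q with
  | old b =>
    have hib : (Fork.old S.i : S.Fork) ≤ Fork.old b := hF.old_le_old.mpr hle
    rw [← (htq.eq_or_eq hF.t_covBy_i.le hib).resolve_left nofun]
    rfl
  | t => exact absurd rfl htq.ne
  | z s x y h => exact absurd hle h.lt_i.not_ge

variable {lam : L → L → Prop}

theorem covBy_shadow_of_z_covBy (hF : S.HasForkOrder) (hL : HasAtMostTwoUpperCovers L)
    (hlam : IsConjugateOrder lam) {s : Side} {x y : L} (h : S.Leg s x y) {q : S.Fork}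
    (hq : ¬ q.IsHigh) (hzq : Fork.z s x y h ⋖ q) : x ⋖ q.shadow := by
  have hlt : x < q.shadow :=
    (hF.z_le_iff.mp hzq.le).lt_of_not_ge fun hqx =>
      hzq.lt.not_ge ((hF.le_iff_of_not_isHigh hq).mpr hqx)
  have hlow := Fork.shadow_mem_lowSet hq
  cases h with
  | base =>
    rw [((S.side_covBy_i s).eq_or_eq hlt.le (le_i_of_mem_lowSet hlow)).resolve_left hlt.ne']
    exact S.side_covBy_i s
  | @step x₀ y₀ _ _ h₀ hsq =>
    have hzz : Fork.z s x y (.step h₀ hsq) < Fork.z s x₀ y₀ h₀ :=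
      (hF.z_le_iff.mpr hsq.left_covBy_top.le).lt_of_not_ge fun hle =>
        hsq.left_covBy_top.lt.not_ge (hF.z_le_iff.mp hle)
    have hle : Fork.z s x₀ y₀ h₀ ≤ q :=
      hF.z_le_iff.mpr (h₀.le_of_lt_of_mem_lowSet hL hlam hsq hlow hlt)
    rw [← (hzq.eq_or_eq hzz.le hle).resolve_left hzz.ne']
    exact hsq.left_covBy_top

variable [Finite L]

theorem principal_y_z (hF : S.HasForkOrder) (hL : HasAtMostTwoUpperCovers L) {s : Side} {x y : L}
    (h : S.Leg s x y) :
    principal (Fork.old y) (Fork.z s x y h) =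
      principal (Fork.old (S.side s.opp)) (Fork.old S.i) := by
  have hinf : Fork.z s x y h ⊓ Fork.old (S.side s.opp) = Fork.old y :=
    hF.inf_eq_of_code_eq (Prod.ext h.inf_side_opp.symm
      (propext (iff_of_false (fun hy => hy h.le_o) And.left)))
  have hsup : Fork.z s x y h ⊔ Fork.old (S.side s.opp) = Fork.old S.i :=
    hF.sup_eq (Prod.ext (h.sup_eq_i_of_opp hL .base).symm
      (propext (iff_of_true S.o_lt_i.not_ge (.inr (Leg.not_le_o .base)))))
  have key := principal_inf_eq_principal_sup (Fork.z s x y h) (Fork.old (S.side s.opp))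
  rwa [hinf, hsup] at key

theorem exists_covBy_principal_old_eq (hF : S.HasForkOrder) (hL : HasAtMostTwoUpperCovers L)
    {a : L} {q : S.Fork} (haq : Fork.old a ⋖ q) :
    ∃ b c : L, b ⋖ c ∧ principal (Fork.old a) q = principal (Fork.old b) (Fork.old c) := by
  obtain ⟨hle, hhigh⟩ := (hF _ _).mp haq.le
  cases q with
  | old b => exact ⟨a, b, hF.covBy_of_old_covBy_old haq, rfl⟩
  | t =>
    have haz : Fork.old a ≤ Fork.z .left _ _ (Leg.base (S := S)) :=
      (hF _ _).mpr ⟨(not_not.mp hhigh).trans (S.o_covBy_side .left).le, hhigh⟩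
    have hzt : Fork.z .left _ _ Leg.base ≤ (Fork.t : S.Fork) :=
      hF.z_le_iff.mpr (S.side_covBy_i .left).le
    exact (haq.eq_or_eq haz hzt).elim nofun nofun
  | z s x y h =>
    have hay : Fork.old a ≤ Fork.old y :=
      hF.old_le_old.mpr (h.inf_o ▸ le_inf hle (not_not.mp hhigh))
    have hyz : Fork.old y ≤ Fork.z s x y h := (hF _ _).mpr ⟨h.covBy.le, absurd h.le_o⟩
    rw [← (haq.eq_or_eq hay hyz).resolve_right nofun]
    exact ⟨_, _, S.side_covBy_i s.opp, hF.principal_y_z hL h⟩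

theorem principal_eq_gamma_or (hF : S.HasForkOrder) (hL : HasAtMostTwoUpperCovers L)
    (hlam : IsConjugateOrder lam) {p q : S.Fork} (hpq : p ⋖ q) :
    principal p q = S.gamma ∨
      ∃ a b : L, a ⋖ b ∧ principal p q = principal (Fork.old a) (Fork.old b) := by
  cases p with
  | old a => exact .inr (hF.exists_covBy_principal_old_eq hL hpq)
  | t => exact .inl (hF.principal_t_eq_gamma hpq)
  | z s x y h =>
    have hxq : x ≤ q.shadow := hF.z_le_iff.mp hpq.le
    by_cases hq : q.IsHigh
    · have hzx : Fork.z s x y h ≤ Fork.old x := hF.le_old_iff.mpr le_rfl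
      have hxq' : Fork.old x ≤ q := (hF _ _).mpr ⟨hxq, fun _ => hq⟩
      rw [← (hpq.eq_or_eq hzx hxq').resolve_left nofun]
      exact .inl (hF.principal_z_x h)
    · exact .inr ⟨x, q.shadow, hF.covBy_shadow_of_z_covBy hL hlam h hq hpq,
        hF.principal_z_of_not_isHigh h hq hxq⟩

variable [IsUpperModularLattice L]

theorem gamma_ne_minimalExtension (hF : S.HasForkOrder) (hL : HasAtMostTwoUpperCovers L)
    (hlam : IsConjugateOrder lam) (hS : S.IsTight) (α : LatticeCon L) :
    S.gamma ≠ S.minimalExtension α := by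
  intro heq
  have hshadow : S.gamma ≤ hF.shadowCon hL hlam hS :=
    principal_le_iff.mpr (CollapsedBelow.refl S.i S.i)
  have hlevel : S.minimalExtension α ≤ hF.levelCon hL hlam hS := by
    refine gen_le ?_
    rintro _ _ ⟨a, b, hab, rfl, rfl⟩
    have hcol : CollapsedBelow S.i a b :=
      (heq ▸ hshadow : S.minimalExtension α ≤ _) (rel_gen ⟨a, b, hab, rfl, rfl⟩)
    exact ⟨hcol, not_congr ⟨S.le_o_of_collapsedBelow hL hcol,
      S.le_o_of_collapsedBelow hL hcol.symm⟩⟩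
  have hti : (hF.levelCon hL hlam hS).r Fork.t (Fork.old S.i) :=
    (heq ▸ hlevel : S.gamma ≤ _) (rel_principal _ _)
  exact hti.2.mpr S.o_lt_i.not_ge

theorem new_supIrred_eq (hF : S.HasForkOrder) (hL : HasAtMostTwoUpperCovers L)
    (hlam : IsConjugateOrder lam) (hS : S.IsTight) :
    {θ : LatticeCon S.Fork | SupIrred θ ∧
      ¬ ∃ α : LatticeCon L, SupIrred α ∧ θ = S.minimalExtension α} = {S.gamma} := by
  have : Finite S.Fork := .of_injective Fork.code Fork.code_injective
  ext θ
  refine ⟨fun ⟨hθ, hnew⟩ => ?_, ?_⟩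
  · obtain ⟨p, q, hpq, rfl⟩ := exists_covBy_eq_principal_of_supIrred hθ
    refine (hF.principal_eq_gamma_or hL hlam hpq).resolve_right fun ⟨a, b, hab, heq⟩ => ?_
    exact hnew ⟨principal a b, supIrred_principal hab, by rw [heq, hF.minimalExtension_principal]⟩
  · rintro rfl
    exact ⟨supIrred_principal hF.t_covBy_i,
      fun ⟨α, _, heq⟩ => hF.gamma_ne_minimalExtension hL hlam hS α heq⟩

end CoveringSquare.HasForkOrder

theorem IsSPS.exists_isConjugateOrder {L : Type*} [Lattice L] [Nonempty L] (hL : IsSPS L) :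
    ∃ lam : L → L → Prop, IsConjugateOrder lam := by
  have := hL.planar.1
  let := Fintype.ofFinite L
  let := Fintype.toBoundedOrder L
  exact hL.planar.exists_isConjugateOrder

theorem theorem3 {L : Type*} [Lattice L] (hL : IsSPS L) (S : CoveringSquare L) (hS : S.IsTight) :
    ∃ _ : Lattice S.Fork,
      (∀ p q : S.Fork, p ≤ q ↔ S.ForkLE p q) ∧
      (∀ a b : L, (CoveringSquare.Fork.old (a ⊔ b) : S.Fork) =
        CoveringSquare.Fork.old a ⊔ CoveringSquare.Fork.old b) ∧
      (∀ a b : L, (CoveringSquare.Fork.old (a ⊓ b) : S.Fork) =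
        CoveringSquare.Fork.old a ⊓ CoveringSquare.Fork.old b) ∧
      {θ : LatticeCon S.Fork | SupIrred θ ∧
        ¬ ∃ α : LatticeCon L, SupIrred α ∧ θ = S.minimalExtension α} = {S.gamma} := by
  have : Nonempty L := ⟨S.o⟩
  have : Finite L := hL.planar.1
  have : IsUpperModularLattice L := hL.semimodular
  obtain ⟨lam, hlam⟩ := hL.exists_isConjugateOrder
  have hcov := hL.slim.hasAtMostTwoUpperCovers hlam
  obtain ⟨_, hF⟩ := CoveringSquare.exists_lattice_hasForkOrder hcov hlam hS
  exact ⟨_, fun p q => (hF p q).trans (CoveringSquare.forkLE_iff hcov hlam).symm,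
    fun a b => (hF.old_sup_old a b).symm, fun a b => (hF.old_inf_old a b).symm,
    hF.new_supIrred_eq hcov hlam hS⟩
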